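/- Let $n,m,k,l$ be non-negative integers with $m\le n$, $k\le n$ and $m+k-n\le l\le \min(m,k)$, and put $M:=m-l$, $N:=n-m-k+l$. In $(\mathbb C^2)^{\otimes n}$, with its standard Hermitian form and orthonormal basis $|i_1\cdots i_n\rangle$, $i_j\in\{0,1\}$, consider the unit vector $$|\Xi_{n,m|k,l}\rangle:=|1\rangle^{\otimes l}\otimes|0\rangle^{\otimes(k-l)}\otimes\binom{M+N}{M}^{-1/2}\sum_{w}|w\rangle ,$$ where $w$ runs over the words in $\{0,1\}^{M+N}$ with exactly $M$ letters equal to $1$. The symmetric group $\mathfrak S_n$ acts by $\pi(g)|i_1\cdots i_n\rangle=|i_{g^{-1}(1)}\cdots i_{g^{-1}(n)}\rangle$. For $0\le x\le\lfloor n/2\rfloor$ let $\mathsf P_{(n-x,x)}$ be the orthogonal projector onto the isotypical component of the irreducible $\mathfrak S_n$-representation (Specht module) corresponding to the partition $(n-x,x)$, and let $$p(x):=\langle\Xi_{n,m|k,l}|\,\mathsf P_{(n-x,x)}\,|\Xi_{n,m|k,l}\rangle .$$ (1) If $m\le n-m$ and $0\le x\le m$, then $$a_x\,\frac{n-x}{n-2x-1}\binom{n}{x+1}^{-1}p(x+1)-(a_x+c_x-MN)\,\frac{n-x+1}{n-2x+1}\binom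 nx^{-1}p(x)+c_x\,\frac{n-x+2}{n-2x+3}\binom{n}{x-1}^{-1}p(x-1)=0,$$ where $$a_x:=\frac{(m-x)(n-m-x)(n-k-x)(n-x+1)}{(n-2x)(n-2x+1)},\qquad c_x:=\frac{x(x-k-1)(m-x+1)(n-m-x+1)}{(n-2x+1)(n-2x+2)}.$$ Here the first term is regarded as $0$ if $x=m$, the third term is regarded as $0$ if $x=0$, and $a_m$ is read as $0$ also when $n=2m$. (2) For all $n,m,k,l$ as above (without assuming $m\le n-m$), $p(x)=0$ for every integer $x$ with $\min(m,n-m,k)<x\le\lfloor n/2\rfloor$. -/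

import Mathlib

namespace AsymState

noncomputable section

/-- The `n`-qubit space `(ℂ²)^{⊗n}`, written in coordinates with respect to its computational
orthonormal basis `|i₁ … iₙ⟩`, `i₁, …, iₙ ∈ {0, 1}`. -/
abbrev Qubits (n : ℕ) : Type := EuclideanSpace ℂ (Fin n → Fin 2)

/-- The basis vector `|w₁ … wₙ⟩ = |w₁⟩ ⊗ ⋯ ⊗ |wₙ⟩`. -/
def ket {n : ℕ} (w : Fin n → Fin 2) : Qubits n := EuclideanSpace.single w 1

/-- The tensor product `φ ⊗ ψ ∈ (ℂ²)^{⊗n}` of `φ ∈ (ℂ²)^{⊗k}` and `ψ ∈ (ℂ²)^{⊗(n-k)}`: the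
amplitude at a word of length `n` is the product of the amplitude of `φ` at its first `k` letters
and the amplitude of `ψ` at its last `n - k` letters. -/
def tensor {n k : ℕ} (hk : k ≤ n) (φ : Qubits k) (ψ : Qubits (n - k)) : Qubits n :=
  WithLp.toLp 2 fun w =>
    φ (fun i => w ⟨i, lt_of_lt_of_le i.2 hk⟩) *
      ψ (fun j => w ⟨k + j, by have := j.2; omega⟩)

/-- The vector `|1^l 0^{k-l}⟩ ∈ (ℂ²)^{⊗k}`. -/
def onesZeros (k l : ℕ) : Qubits k :=
  ket fun i => if (i : ℕ) < l then 1 else 0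

/-- The Dicke state `|Ξ_{r,s}⟩ = C(r,s)^{-1/2} (|1^s 0^{r-s}⟩ + permuted terms)`: the normalized
sum of all basis vectors of `(ℂ²)^{⊗r}` with exactly `s` letters equal to `1`. -/
def dicke (r s : ℕ) : Qubits r :=
  ((Real.sqrt (r.choose s : ℝ) : ℂ))⁻¹ •
    ∑ w : Fin r → Fin 2 with (Finset.univ.filter fun i => w i = 1).card = s, ket w

/-- The state `|Ξ_{n,m|k,l}⟩ = |1^l 0^{k-l}⟩ ⊗ |Ξ_{n-k,m-l}⟩ ∈ (ℂ²)^{⊗n}`. -/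
def stateXi (n m k l : ℕ) (hk : k ≤ n) : Qubits n :=
  tensor hk (onesZeros k l) (dicke (n - k) (m - l))

/-- The action of `𝔖ₙ` on `(ℂ²)^{⊗n}` by permutation of the tensor factors,
`π(g)|i₁ … iₙ⟩ = |i_{g⁻¹(1)} … i_{g⁻¹(n)}⟩` (see `permRep_ket`). -/
def permRep (n : ℕ) : Representation ℂ (Equiv.Perm (Fin n)) (Qubits n) where
  toFun g :=
    { toFun := fun ψ => WithLp.toLp 2 fun w => ψ (w ∘ g)
      map_add' := fun _ _ => rfl
      map_smul' := fun _ _ => rfl }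
  map_one' := rfl
  map_mul' _ _ := rfl

theorem permRep_ket {n : ℕ} (g : Equiv.Perm (Fin n)) (w : Fin n → Fin 2) :
    permRep n g (ket w) = ket (w ∘ (g⁻¹ : Equiv.Perm (Fin n))) := by
  ext v
  have h : v ∘ g = w ↔ v = w ∘ (g⁻¹ : Equiv.Perm (Fin n)) := by
    constructor
    · rintro rfl; ext i; simp
    · rintro rfl; ext i; simp
  change (EuclideanSpace.single w (1 : ℂ) : Qubits n) (v ∘ g) =
    (EuclideanSpace.single (w ∘ (g⁻¹ : Equiv.Perm (Fin n))) (1 : ℂ) : Qubits n) v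
  rw [PiLp.single_apply, PiLp.single_apply]
  exact if_congr h rfl rfl

/-- The row (`0` or `1`) containing the entry `i` in the standard tableau of shape `(n-x, x)`
whose first row is `0, 1, …, n-x-1` and whose second row is `n-x, …, n-1`. -/
def tabRow (n x : ℕ) (i : Fin n) : ℕ := if (i : ℕ) < n - x then 0 else 1

/-- The column containing the entry `i` in the same tableau. -/
def tabCol (n x : ℕ) (i : Fin n) : ℕ := if (i : ℕ) < n - x then i else i - (n - x)

/-- The sum, in the group algebra, of all permutations that preserve every row of the tableau. -/
def rowSymmetrizer (n x : ℕ) : MonoidAlgebra ℂ (Equiv.Perm (Fin n)) :=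
  ∑ g : Equiv.Perm (Fin n) with ∀ i, tabRow n x (g i) = tabRow n x i, MonoidAlgebra.single g 1

/-- The signed sum of all permutations that preserve every column of the tableau. -/
def columnAntisymmetrizer (n x : ℕ) : MonoidAlgebra ℂ (Equiv.Perm (Fin n)) :=
  ∑ g : Equiv.Perm (Fin n) with ∀ i, tabCol n x (g i) = tabCol n x i,
    MonoidAlgebra.single g ((Equiv.Perm.sign g : ℤ) : ℂ)

/-- For `2 * x ≤ n`, the irreducible representation `𝒱_{(n-x,x)}` of `𝔖ₙ` corresponding to the
partition `(n-x, x)` (the Specht module): the left ideal of the group algebra generated by the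
Young symmetrizer of a tableau of this shape. For `x = 0` it is the trivial representation. -/
def specht (n x : ℕ) : Submodule (MonoidAlgebra ℂ (Equiv.Perm (Fin n)))
    (MonoidAlgebra ℂ (Equiv.Perm (Fin n))) :=
  Submodule.span _ {columnAntisymmetrizer n x * rowSymmetrizer n x}

/-- The isotypical component of `(ℂ²)^{⊗n}` belonging to `𝒱_{(n-x,x)}`, i.e. the summand
`𝒰_{(n-x,x)} ⊠ 𝒱_{(n-x,x)}` of the Schur-Weyl decomposition, as a complex subspace. -/
def isotypical (n x : ℕ) : Submodule ℂ (Qubits n) :=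
  (Subrepresentation.ofSubmodule' (ρ := permRep n)
    (isotypicComponent (MonoidAlgebra ℂ (Equiv.Perm (Fin n))) (permRep n).asModule
      (specht n x))).toSubmodule

/-- The orthogonal projector `P_{(n-x,x)}` onto the isotypical component. -/
def projector (n x : ℕ) : Qubits n →L[ℂ] Qubits n := (isotypical n x).starProjection

/-- The probability mass function
`p(x) = p(x | n,m,k,l) = ⟨Ξ_{n,m|k,l}| P_{(n-x,x)} |Ξ_{n,m|k,l}⟩`, for `2 * x ≤ n`.
The bracket is a real number by `pmf_eq_inner`. -/
def pmf (n m k l : ℕ) (hk : k ≤ n) (x : ℕ) : ℝ :=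
  (inner ℂ (stateXi n m k l hk) (projector n x (stateXi n m k l hk))).re

theorem pmf_eq_inner (n m k l : ℕ) (hk : k ≤ n) (x : ℕ) :
    (pmf n m k l hk x : ℂ) =
      inner ℂ (stateXi n m k l hk) (projector n x (stateXi n m k l hk)) := by
  unfold pmf projector
  generalize stateXi n m k l hk = v
  rw [← Submodule.inner_starProjection_left_eq_right]
  apply Complex.conj_eq_iff_re.mp
  rw [inner_conj_symm, ← Submodule.inner_starProjection_left_eq_right]

/-- The coefficient `a_x`. In the range `0 ≤ x ≤ m ≤ n - m` its denominator vanishes only for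
`x = m = n - m`; the quotient is then read as `0`, which is also the value at `x = m` for all
other `n`. -/
def recA (n m k x : ℕ) : ℝ :=
  (((m : ℝ) - x) * ((n : ℝ) - m - x) * ((n : ℝ) - k - x) * ((n : ℝ) - x + 1)) /
    (((n : ℝ) - 2 * x) * ((n : ℝ) - 2 * x + 1))

/-- The coefficient `c_x`. -/
def recC (n m k x : ℕ) : ℝ :=
  ((x : ℝ) * ((x : ℝ) - k - 1) * ((m : ℝ) - x + 1) * ((n : ℝ) - m - x + 1)) /
    (((n : ℝ) - 2 * x + 1) * ((n : ℝ) - 2 * x + 2))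

end

end AsymState

/-! ### The group algebra, two-row tableaux and the class sum of transpositions -/

namespace AsymState

open Equiv

/-! The sum `swapSum` of all transpositions is central, and on the Specht module of shape $(n-x,x)$
it acts by the scalar $n^2-2x(n+1-x)$. These scalars differ for different $x\le n/2$, and only
shapes with at most two rows occur in $(\mathbb C^2)^{\otimes n}$. Hence each isotypical component
is exactly an eigenspace of one self-adjoint operator (`isotypical_eq_swapSpace`), and the
projectors become spectral projectors.

For $2m\le n$, on words of weight $m$ this operator is essentially the adjacency operator of the
Johnson graph. In the basis of functions $\binom ei$ of the Johnson distance $e$ it is bidiagonal,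
so its eigenvectors can be written down with explicit (dual) Hahn coefficients. Weighting them by
the Specht dimensions gives a resolution of the identity, and `projector_eq_hahnVec` computes the
projector on any vector of weight $m$.

Pairing with $\Xi$ turns $\binom ei$ into a count of pairs of sets, so `pmf_eq` writes $p(x)/\dim$
as a constant times a balanced ${}_4F_3$ sum, a Racah polynomial in $\lambda(x)=x(n+1-x)$. The
factor $\frac{n-x+1}{n-2x+1}\binom nx^{-1}$ of the recurrence is the inverse dimension. The
recurrence is therefore the difference equation in $x$ of Racah polynomials, and it follows by a
telescoping sum over the hypergeometric index (`racahSum_difference`).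

The vanishing of $p$ is independent of all this: outside the stated range, a pigeonhole argument
finds in each case a column whose transposition fixes the vector, so the column antisymmetrizer
kills every translate of $\Xi$ (`projector_eq_zero`). -/

/-- The permutation `g` as an element of the group algebra. -/
noncomputable def grp {n : ℕ} (g : Perm (Fin n)) : MonoidAlgebra ℂ (Perm (Fin n)) := MonoidAlgebra.single g 1

theorem grp_mul {n : ℕ} (g h : Perm (Fin n)) : grp (g * h) = grp g * grp h := by
  simp [grp, MonoidAlgebra.single_mul_single]

theorem single_eq_smul_grp {n : ℕ} (g : Perm (Fin n)) (z : ℂ) :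
    MonoidAlgebra.single g z = z • grp g := by
  simp [grp]

theorem grp_induction {n : ℕ} {P : MonoidAlgebra ℂ (Perm (Fin n)) → Prop}
    (x : MonoidAlgebra ℂ (Perm (Fin n))) (of : ∀ g, P (grp g))
    (add : ∀ x y, P x → P y → P (x + y)) (smul : ∀ (r : ℂ) x, P x → P (r • x)) : P x :=
  MonoidAlgebra.induction_on x of add smul

section Tableau

variable {n x : ℕ}

/-- The entry of column `c` in the first row of the tableau of shape `(n-x, x)`. -/
def lo (h : 2 * x ≤ n) (c : Fin x) : Fin n := ⟨c, by omega⟩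

/-- The entry of column `c` in the second row of the tableau of shape `(n-x, x)`. -/
def hi (h : 2 * x ≤ n) (c : Fin x) : Fin n := ⟨n - x + c, by omega⟩

theorem tabCol_lo (h : 2 * x ≤ n) (c : Fin x) : tabCol n x (lo h c) = c := by
  have h1 : ((lo h c : Fin n) : ℕ) < n - x := show (c : ℕ) < n - x by omega
  rw [tabCol, if_pos h1]; rfl

theorem tabCol_hi (h : 2 * x ≤ n) (c : Fin x) : tabCol n x (hi h c) = c := by
  have h1 : ¬ ((hi h c : Fin n) : ℕ) < n - x := show ¬ (n - x + (c : ℕ) < n - x) by omega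
  rw [tabCol, if_neg h1]; exact Nat.add_sub_cancel_left _ _

theorem tabRow_lo (h : 2 * x ≤ n) (c : Fin x) : tabRow n x (lo h c) = 0 := by
  have h1 : ((lo h c : Fin n) : ℕ) < n - x := show (c : ℕ) < n - x by omega
  rw [tabRow, if_pos h1]

theorem tabRow_hi (h : 2 * x ≤ n) (c : Fin x) : tabRow n x (hi h c) = 1 := by
  have h1 : ¬ ((hi h c : Fin n) : ℕ) < n - x := show ¬ (n - x + (c : ℕ) < n - x) by omega
  rw [tabRow, if_neg h1]

theorem eq_of_tabRow_tabCol {i j : Fin n} (hr : tabRow n x i = tabRow n x j)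
    (hc : tabCol n x i = tabCol n x j) : i = j := by
  ext
  simp only [tabRow, tabCol] at hr hc
  split_ifs at * <;> omega

theorem tabRow_eq_zero_or_one (i : Fin n) : tabRow n x i = 0 ∨ tabRow n x i = 1 := by
  simp only [tabRow]; split_ifs <;> simp

theorem tabCol_cases (h : 2 * x ≤ n) {i j : Fin n} (hne : i ≠ j)
    (hc : tabCol n x i = tabCol n x j) :
    ∃ c : Fin x, (i = lo h c ∧ j = hi h c) ∨ (i = hi h c ∧ j = lo h c) := by
  have hi' := i.2
  have hj' := j.2
  have hne' : (i : ℕ) ≠ j := fun e => hne (Fin.ext e)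
  simp only [tabCol] at hc
  simp only [Fin.ext_iff, lo, hi]
  split_ifs at hc with h1 h2 h2
  · omega
  · exact ⟨⟨j - (n - x), by omega⟩, Or.inl ⟨by simp; omega, by simp; omega⟩⟩
  · exact ⟨⟨i - (n - x), by omega⟩, Or.inr ⟨by simp; omega, by simp; omega⟩⟩
  · omega

theorem exists_eq_hi (h : 2 * x ≤ n) {i : Fin n} (hr : tabRow n x i = 1) :
    ∃ c : Fin x, i = hi h c := by
  have := i.2
  simp only [tabRow] at hr
  split_ifs at hr with h1
  exact ⟨⟨i - (n - x), by omega⟩, by simp [Fin.ext_iff, hi]; omega⟩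

/-- A set meeting every two-element column has at least `x` elements. -/
theorem card_ge_of_meets_columns (h : 2 * x ≤ n) (S : Finset (Fin n))
    (hS : ∀ c : Fin x, lo h c ∈ S ∨ hi h c ∈ S) : x ≤ S.card := by
  classical
  let f : Fin x → Fin n := fun c => if lo h c ∈ S then lo h c else hi h c
  have hf : ∀ c, tabCol n x (f c) = c := fun c => by
    simp only [f]; split_ifs; exacts [tabCol_lo h c, tabCol_hi h c]
  have hinj : Function.Injective f := fun c d e => Fin.ext (by rw [← hf c, ← hf d, e])
  have hsub : Finset.univ.image f ⊆ S := by
    intro i hi'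
    obtain ⟨c, -, rfl⟩ := Finset.mem_image.1 hi'
    simp only [f]
    split_ifs with h1
    exacts [h1, (hS c).resolve_left h1]
  simpa [Finset.card_image_of_injective _ hinj] using Finset.card_le_card hsub

/-- A set of at most `x` elements that meets every two-element column lies in their union. -/
theorem mem_columns_of_meets (h : 2 * x ≤ n) (S : Finset (Fin n)) (hcard : S.card ≤ x)
    (hS : ∀ c : Fin x, lo h c ∈ S ∨ hi h c ∈ S) {i : Fin n} (hi' : i ∈ S) :
    ∃ c : Fin x, i = lo h c ∨ i = hi h c := by
  classical
  by_contra! hcon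
  have h1 : x ≤ (S.erase i).card := card_ge_of_meets_columns h _ fun c =>
    (hS c).imp (fun h2 => Finset.mem_erase.2 ⟨(hcon c).1.symm, h2⟩)
      (fun h2 => Finset.mem_erase.2 ⟨(hcon c).2.symm, h2⟩)
  have h2 := Finset.card_erase_lt_of_mem hi'
  omega

/-- `g` preserves every row of the tableau of shape `(n-x, x)`. -/
def IsRow (n x : ℕ) (g : Perm (Fin n)) : Prop := ∀ i, tabRow n x (g i) = tabRow n x i

/-- `g` preserves every column of the tableau of shape `(n-x, x)`. -/
def IsCol (n x : ℕ) (g : Perm (Fin n)) : Prop := ∀ i, tabCol n x (g i) = tabCol n x i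

instance (n x : ℕ) : DecidablePred (IsRow n x) := fun g => by unfold IsRow; infer_instance
instance (n x : ℕ) : DecidablePred (IsCol n x) := fun g => by unfold IsCol; infer_instance

theorem IsRow.mul {g h : Perm (Fin n)} (hg : IsRow n x g) (hh : IsRow n x h) :
    IsRow n x (g * h) := fun i => (hg (h i)).trans (hh i)

theorem IsCol.mul {g h : Perm (Fin n)} (hg : IsCol n x g) (hh : IsCol n x h) :
    IsCol n x (g * h) := fun i => (hg (h i)).trans (hh i)

theorem IsRow.inv {g : Perm (Fin n)} (hg : IsRow n x g) : IsRow n x g⁻¹ := fun i => by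
  simpa using (hg (g⁻¹ i)).symm

theorem IsCol.inv {g : Perm (Fin n)} (hg : IsCol n x g) : IsCol n x g⁻¹ := fun i => by
  simpa using (hg (g⁻¹ i)).symm

theorem isRow_swap {i j : Fin n} (h : tabRow n x i = tabRow n x j) : IsRow n x (swap i j) := by
  intro l
  rw [swap_apply_def]; split_ifs with h1 h2
  · rw [h1, h]
  · rw [h2, h]
  · rfl

theorem isCol_swap {i j : Fin n} (h : tabCol n x i = tabCol n x j) : IsCol n x (swap i j) := by
  intro l
  rw [swap_apply_def]; split_ifs with h1 h2
  · rw [h1, h]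
  · rw [h2, h]
  · rfl

theorem rowSymmetrizer_eq (n x : ℕ) :
    rowSymmetrizer n x = ∑ g : Perm (Fin n) with IsRow n x g, grp g := by
  unfold rowSymmetrizer
  exact Finset.sum_congr (Finset.filter_congr fun _ _ => Iff.rfl) fun _ _ => rfl

theorem columnAntisymmetrizer_eq (n x : ℕ) :
    columnAntisymmetrizer n x =
      ∑ g : Perm (Fin n) with IsCol n x g, ((Perm.sign g : ℤ) : ℂ) • grp g := by
  unfold columnAntisymmetrizer
  exact Finset.sum_congr (Finset.filter_congr fun _ _ => Iff.rfl) fun _ _ => single_eq_smul_grp _ _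

theorem grp_mul_rowSymmetrizer {r : Perm (Fin n)} (hr : IsRow n x r) :
    grp r * rowSymmetrizer n x = rowSymmetrizer n x := by
  rw [rowSymmetrizer_eq, Finset.mul_sum]
  refine Finset.sum_bij' (fun g _ => r * g) (fun g _ => r⁻¹ * g) ?_ ?_ ?_ ?_ ?_
  · intro g hg; simpa using hr.mul (by simpa using hg)
  · intro g hg; simpa using hr.inv.mul (by simpa using hg)
  · intro g _; simp
  · intro g _; simp
  · intro g _; rw [grp_mul]

theorem columnAntisymmetrizer_mul_grp {p : Perm (Fin n)} (hp : IsCol n x p) :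
    columnAntisymmetrizer n x * grp p =
      ((Perm.sign p : ℤ) : ℂ) • columnAntisymmetrizer n x := by
  rw [columnAntisymmetrizer_eq, Finset.sum_mul, Finset.smul_sum]
  refine Finset.sum_bij' (fun g _ => g * p) (fun g _ => g * p⁻¹) ?_ ?_ ?_ ?_ ?_
  · intro g hg; simpa using IsCol.mul (by simpa using hg) hp
  · intro g hg; simpa using IsCol.mul (by simpa using hg) hp.inv
  · intro g _; simp
  · intro g _; simp
  · intro g _
    have h1 : ((Perm.sign p : ℤ) : ℂ) * ((Perm.sign p : ℤ) : ℂ) = 1 := by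
      rw [← Int.cast_mul]
      simp
    rw [grp_mul, smul_mul_assoc, smul_smul, Perm.sign_mul]
    congr 1
    push_cast
    linear_combination (-((Perm.sign g : ℤ) : ℂ)) * h1

/-- The row transposition of `g⁻¹ u` and `g⁻¹ v` is absorbed on the right. Carried through `g` it
becomes the column transposition of `u` and `v`, which costs a sign, so the product equals its own
negative. -/
theorem mul_grp_swap_mul_eq_zero {g : Perm (Fin n)} {u v : Fin n} (huv : u ≠ v)
    (hc : tabCol n x u = tabCol n x v) (hr : tabRow n x (g⁻¹ u) = tabRow n x (g⁻¹ v)) :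
    columnAntisymmetrizer n x * grp g * rowSymmetrizer n x = 0 := by
  have h1 : g * swap (g⁻¹ u) (g⁻¹ v) = swap u v * g := by
    rw [mul_swap_eq_swap_mul]; simp
  have h2 : columnAntisymmetrizer n x * grp g * rowSymmetrizer n x =
      -(columnAntisymmetrizer n x * grp g * rowSymmetrizer n x) := by
    conv_lhs => rw [← grp_mul_rowSymmetrizer (isRow_swap hr), ← mul_assoc, mul_assoc _ (grp g),
      ← grp_mul, h1, grp_mul, ← mul_assoc, columnAntisymmetrizer_mul_grp (isCol_swap hc),
      Perm.sign_swap huv]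
    simp
  have h3 : (2 : ℂ) • (columnAntisymmetrizer n x * grp g * rowSymmetrizer n x) = 0 := by
    rw [two_smul]
    nth_rewrite 2 [h2]
    exact add_neg_cancel _
  exact (smul_eq_zero.1 h3).resolve_left two_ne_zero

theorem card_tabRow_one (h : 2 * x ≤ n) (g : Perm (Fin n)) :
    (Finset.univ.filter fun i => tabRow n x (g i) = 1).card = x := by
  have h1 : (Finset.univ.filter fun i => tabRow n x (g i) = 1) =
      (Finset.univ : Finset (Fin x)).image fun c => g⁻¹ (hi h c) := by
    ext i
    simp only [Finset.mem_filter, Finset.mem_univ, true_and, Finset.mem_image]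
    constructor
    · intro hr
      obtain ⟨c, hc⟩ := exists_eq_hi h hr
      exact ⟨c, by simp [← hc]⟩
    · rintro ⟨c, rfl⟩
      simp [tabRow_hi]
  rw [h1, Finset.card_image_of_injective]
  · simp
  · intro c d hcd
    have := g⁻¹.injective hcd
    exact Fin.ext (by rw [← tabCol_hi h c, ← tabCol_hi h d, this])

/-- If no two entries of a column are moved by `g⁻¹` into the same row, then `g` is the product of
a column permutation and a row permutation. -/
theorem exists_col_mul_row (h : 2 * x ≤ n) (g : Perm (Fin n))
    (hg : ∀ c : Fin x, tabRow n x (g⁻¹ (lo h c)) ≠ tabRow n x (g⁻¹ (hi h c))) :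
    ∃ p r : Perm (Fin n), IsCol n x p ∧ IsRow n x r ∧ g = p * r := by
  classical
  -- A factorization `g = p * r` forces `p i` to be the entry in the column of `i` that `g⁻¹` sends
  -- to the row of `i`. It remains to see that such an entry exists.
  have key : ∀ i, ∃ j, tabCol n x j = tabCol n x i ∧
      tabRow n x (g⁻¹ j) = tabRow n x i := by
    intro i
    by_cases h1 : ∃ c : Fin x, i = lo h c ∨ i = hi h c
    · obtain ⟨c, hc⟩ := h1
      have hci : tabCol n x i = c := by
        rcases hc with rfl | rfl
        exacts [tabCol_lo h c, tabCol_hi h c]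
      rw [hci]
      have h2 := hg c
      rcases tabRow_eq_zero_or_one (x := x) i with h3 | h3 <;>
      rcases tabRow_eq_zero_or_one (x := x) (g⁻¹ (lo h c)) with h4 | h4 <;>
      rcases tabRow_eq_zero_or_one (x := x) (g⁻¹ (hi h c)) with h5 | h5 <;>
      first
        | exact absurd (h4.trans h5.symm) h2
        | exact ⟨lo h c, tabCol_lo h c, h4.trans h3.symm⟩
        | exact ⟨hi h c, tabCol_hi h c, h5.trans h3.symm⟩
    · refine ⟨i, rfl, ?_⟩
      have h3 : tabRow n x i = 0 := by
        rcases tabRow_eq_zero_or_one (x := x) i with h3 | h3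
        · exact h3
        · obtain ⟨c, hc⟩ := exists_eq_hi h h3
          exact absurd ⟨c, Or.inr hc⟩ h1
      rw [h3]
      rcases tabRow_eq_zero_or_one (x := x) (g⁻¹ i) with h4 | h4
      · exact h4
      -- The `x` entries sent to the second row meet each of the `x` two-element columns, so none is
      -- left over for a column of length one.
      · refine absurd (mem_columns_of_meets h
          (Finset.univ.filter fun i => tabRow n x (g⁻¹ i) = 1) (card_tabRow_one h g⁻¹).le ?_
          (by simpa using h4)) h1
        intro c
        have h2 := hg c
        rcases tabRow_eq_zero_or_one (x := x) (g⁻¹ (lo h c)) with h4 | h4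
        · rcases tabRow_eq_zero_or_one (x := x) (g⁻¹ (hi h c)) with h5 | h5
          · exact absurd (h4.trans h5.symm) h2
          · exact Or.inr (by simpa using h5)
        · exact Or.inl (by simpa using h4)
  choose p hp1 hp2 using key
  have hinj : Function.Injective p := fun i j hij =>
    eq_of_tabRow_tabCol (by rw [← hp2 i, ← hp2 j, hij]) (by rw [← hp1 i, ← hp1 j, hij])
  let P : Perm (Fin n) := Equiv.ofBijective p (Finite.injective_iff_bijective.1 hinj)
  refine ⟨P, P⁻¹ * g, hp1, ?_, by simp⟩
  have : IsRow n x (g⁻¹ * P) := hp2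
  simpa using this.inv

/-- Von Neumann's lemma. For a single permutation, either it factors as column times row and both
factors are absorbed up to a sign, or some column is sent into one row and the product vanishes. -/
theorem exists_smul_of_sandwich (h : 2 * x ≤ n) (y : MonoidAlgebra ℂ (Perm (Fin n))) :
    ∃ z : ℂ, columnAntisymmetrizer n x * y * rowSymmetrizer n x =
      z • (columnAntisymmetrizer n x * rowSymmetrizer n x) := by
  induction y using grp_induction with
  | of g =>
    by_cases hg : ∀ c : Fin x, tabRow n x (g⁻¹ (lo h c)) ≠ tabRow n x (g⁻¹ (hi h c))
    · obtain ⟨p, r, hp, hr, rfl⟩ := exists_col_mul_row h g hg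
      refine ⟨((Perm.sign p : ℤ) : ℂ), ?_⟩
      rw [grp_mul, ← mul_assoc, columnAntisymmetrizer_mul_grp hp, mul_assoc,
        grp_mul_rowSymmetrizer hr, smul_mul_assoc]
    · push Not at hg
      obtain ⟨c, hc⟩ := hg
      refine ⟨0, ?_⟩
      rw [zero_smul]
      refine mul_grp_swap_mul_eq_zero ?_ ((tabCol_lo h c).trans (tabCol_hi h c).symm) hc
      intro e
      have := tabRow_lo h c
      rw [e, tabRow_hi] at this
      omega
  | add y z hy hz =>
    obtain ⟨s, hs⟩ := hy
    obtain ⟨t, ht⟩ := hz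
    exact ⟨s + t, by rw [mul_add, add_mul, hs, ht, add_smul]⟩
  | smul r y hy =>
    obtain ⟨s, hs⟩ := hy
    exact ⟨r * s, by rw [mul_smul_comm, smul_mul_assoc, hs, smul_smul]⟩

/-- The sum over all ordered pairs `(i, j)` of the permutation exchanging `i` and `j`. -/
noncomputable def swapSum (n : ℕ) : MonoidAlgebra ℂ (Perm (Fin n)) := ∑ i, ∑ j, grp (swap i j)

/-- Conjugation by `g` only relabels the pairs $(i,j)$. -/
theorem swapSum_comm (y : MonoidAlgebra ℂ (Perm (Fin n))) : swapSum n * y = y * swapSum n := by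
  induction y using grp_induction with
  | of g =>
    simp only [swapSum, Finset.sum_mul, Finset.mul_sum]
    rw [← Equiv.sum_comp g]
    refine Finset.sum_congr rfl fun i _ => ?_
    rw [← Equiv.sum_comp g]
    refine Finset.sum_congr rfl fun j _ => ?_
    rw [← grp_mul, ← grp_mul, mul_swap_eq_swap_mul]
  | add y z hy hz => rw [mul_add, add_mul, hy, hz]
  | smul r y hy => rw [mul_smul_comm, smul_mul_assoc, hy]

/-- The scalar by which `swapSum n` acts on the Specht module of shape `(n-x, x)`. -/
noncomputable def swapEig (n x : ℕ) : ℂ := (n : ℂ) ^ 2 - 2 * x * (n + 1 - x)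

/-- The scalar is $1$ for two entries in the same row (including $i=j$), $-1$ for two distinct
entries of one column, and $0$ otherwise. It is written as a sum of products of functions of $i$ and
$j$ so that the double sum in `swapSum_mul_young` factorizes. -/
theorem sandwich_swap (h : 2 * x ≤ n) (i j : Fin n) :
    columnAntisymmetrizer n x * grp (swap i j) * rowSymmetrizer n x =
      (((1 - (tabRow n x i : ℂ)) * (1 - (tabRow n x j : ℂ)) + tabRow n x i * tabRow n x j) -
        ∑ c : Fin x, ((if i = lo h c then 1 else 0) * (if j = hi h c then 1 else 0) +
          (if i = hi h c then 1 else 0) * (if j = lo h c then 1 else 0))) •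
        (columnAntisymmetrizer n x * rowSymmetrizer n x) := by
  have hlohi : ∀ c d : Fin x, lo h c ≠ hi h d := fun c d e => by
    have := tabRow_lo h c
    rw [e, tabRow_hi] at this
    omega
  have hlo : Function.Injective (lo h) := fun c d e => Fin.ext (by
    rw [← tabCol_lo h c, ← tabCol_lo h d, e])
  have hhi : Function.Injective (hi h) := fun c d e => Fin.ext (by
    rw [← tabCol_hi h c, ← tabCol_hi h d, e])
  by_cases hr : tabRow n x i = tabRow n x j
  · have h1 : ∀ c : Fin x, ((if i = lo h c then 1 else 0) * (if j = hi h c then 1 else 0) +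
          (if i = hi h c then 1 else 0) * (if j = lo h c then 1 else 0) : ℂ) = 0 := by
      intro c
      have h2 : ¬ (i = lo h c ∧ j = hi h c) := by
        rintro ⟨rfl, rfl⟩; rw [tabRow_lo, tabRow_hi] at hr; omega
      have h3 : ¬ (i = hi h c ∧ j = lo h c) := by
        rintro ⟨rfl, rfl⟩; rw [tabRow_lo, tabRow_hi] at hr; omega
      split_ifs <;> simp_all
    rw [Finset.sum_congr rfl fun c _ => h1 c, mul_assoc, grp_mul_rowSymmetrizer (isRow_swap hr)]
    rcases tabRow_eq_zero_or_one (x := x) i with h4 | h4 <;>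
    · rw [← hr, h4]; simp
  · have h0 : ((1 - (tabRow n x i : ℂ)) * (1 - (tabRow n x j : ℂ)) +
        tabRow n x i * tabRow n x j) = 0 := by
      rcases tabRow_eq_zero_or_one (x := x) i with h4 | h4 <;>
      rcases tabRow_eq_zero_or_one (x := x) j with h5 | h5 <;> simp_all
    rw [h0]
    by_cases hc : tabCol n x i = tabCol n x j
    · have hne : i ≠ j := fun e => hr (by rw [e])
      rw [columnAntisymmetrizer_mul_grp (isCol_swap hc), Perm.sign_swap hne]
      obtain ⟨c, ⟨rfl, rfl⟩ | ⟨rfl, rfl⟩⟩ := tabCol_cases h hne hc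
      · simp [hlohi, hlo.eq_iff, hhi.eq_iff]
      · simp [hlohi, (hlohi _ _).symm, hlo.eq_iff, hhi.eq_iff]
    · have h1 : ∀ c : Fin x, ((if i = lo h c then 1 else 0) * (if j = hi h c then 1 else 0) +
          (if i = hi h c then 1 else 0) * (if j = lo h c then 1 else 0) : ℂ) = 0 := by
        intro c
        have h2 : ¬ (i = lo h c ∧ j = hi h c) := by
          rintro ⟨rfl, rfl⟩; rw [tabCol_lo, tabCol_hi] at hc; omega
        have h3 : ¬ (i = hi h c ∧ j = lo h c) := by
          rintro ⟨rfl, rfl⟩; rw [tabCol_lo, tabCol_hi] at hc; omega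
        split_ifs <;> simp_all
      rw [Finset.sum_congr rfl fun c _ => h1 c]
      simp only [Finset.sum_const_zero, sub_zero, zero_smul]
      rcases tabRow_eq_zero_or_one (x := x) i with h4 | h4
      · have h5 : tabRow n x j = 1 :=
          (tabRow_eq_zero_or_one j).resolve_left fun h5 => hr (h4.trans h5.symm)
        obtain ⟨c, rfl⟩ := exists_eq_hi h h5
        have hic : i ≠ lo h c := by rintro rfl; rw [tabCol_lo, tabCol_hi] at hc; omega
        -- The transposition replaces the lower entry of column `c` by `i`, which is in the first
        -- row, and leaves the upper entry alone; both entries of column `c` thus land in one row.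
        refine mul_grp_swap_mul_eq_zero (u := lo h c) (v := hi h c) (hlohi c c)
          ((tabCol_lo h c).trans (tabCol_hi h c).symm) ?_
        rw [swap_inv, swap_apply_right, swap_apply_of_ne_of_ne hic.symm (hlohi c c), h4, tabRow_lo]
      · have h5 : tabRow n x j = 0 :=
          (tabRow_eq_zero_or_one j).resolve_right fun h5 => hr (h4.trans h5.symm)
        obtain ⟨c, rfl⟩ := exists_eq_hi h h4
        have hjc : j ≠ lo h c := by rintro rfl; rw [tabCol_lo, tabCol_hi] at hc; omega
        refine mul_grp_swap_mul_eq_zero (u := lo h c) (v := hi h c) (hlohi c c)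
          ((tabCol_lo h c).trans (tabCol_hi h c).symm) ?_
        rw [swap_inv, swap_apply_left, swap_apply_of_ne_of_ne (hlohi c c) hjc.symm, h5, tabRow_lo]

theorem sum_tabRow (h : 2 * x ≤ n) : ∑ i : Fin n, (tabRow n x i : ℂ) = x := by
  have h1 : ∀ i : Fin n, (tabRow n x i : ℂ) = if tabRow n x i = 1 then 1 else 0 := by
    intro i
    rcases tabRow_eq_zero_or_one (x := x) i with h4 | h4 <;> simp [h4]
  rw [Finset.sum_congr rfl fun i _ => h1 i, Finset.sum_boole]
  exact_mod_cast card_tabRow_one h 1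

/-- By centrality the class sum can be put between the two symmetrizers. Same-row pairs contribute
$(n-x)^2+x^2$, same-column pairs contribute $-2x$. -/
theorem swapSum_mul_young (h : 2 * x ≤ n) :
    swapSum n * (columnAntisymmetrizer n x * rowSymmetrizer n x) =
      swapEig n x • (columnAntisymmetrizer n x * rowSymmetrizer n x) := by
  rw [← mul_assoc, swapSum_comm]
  unfold swapSum
  simp only [Finset.mul_sum, Finset.sum_mul, sandwich_swap h, ← Finset.sum_smul]
  congr 1
  have h2 : ∑ i : Fin n, (1 - (tabRow n x i : ℂ)) = n - x := by
    simp [sum_tabRow h]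
  have h3 : ∀ f g : Fin x → Fin n, ∑ i : Fin n, ∑ j : Fin n, ∑ c : Fin x,
      ((if i = f c then 1 else 0) * (if j = g c then 1 else 0) : ℂ) = x := by
    intro f g
    have : ∀ i : Fin n, ∑ j : Fin n, ∑ c : Fin x,
      ((if i = f c then 1 else 0) * (if j = g c then 1 else 0) : ℂ) =
        ∑ c : Fin x, ∑ j : Fin n,
      ((if i = f c then 1 else 0) * (if j = g c then 1 else 0) : ℂ) := fun i => Finset.sum_comm
    rw [Finset.sum_congr rfl fun i _ => this i, Finset.sum_comm]
    simp
  rw [Finset.sum_congr rfl fun i _ => Finset.sum_sub_distrib _ _, Finset.sum_sub_distrib]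
  simp only [Finset.sum_add_distrib, h3]
  rw [← Finset.sum_mul_sum, ← Finset.sum_mul_sum, h2, sum_tabRow h, swapEig]
  ring

end Tableau

end AsymState

/-! ### Irreducibility of the Specht modules -/

namespace AsymState

open Equiv

section Simple

variable {n x : ℕ}

theorem eq_one_of_isRow_of_isCol {g : Perm (Fin n)} (hr : IsRow n x g) (hc : IsCol n x g) :
    g = 1 :=
  Equiv.ext fun i => eq_of_tabRow_tabCol (hr i) (hc i)

/-- The coefficient at the identity is $1$, since only the identity preserves both rows and columns.
-/
theorem young_ne_zero (n x : ℕ) : columnAntisymmetrizer n x * rowSymmetrizer n x ≠ 0 := by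
  intro h0
  have h1 : (columnAntisymmetrizer n x * rowSymmetrizer n x).coeff 1 = 1 := by
    rw [columnAntisymmetrizer_eq, rowSymmetrizer_eq, Finset.sum_mul_sum]
    simp only [smul_mul_assoc, ← grp_mul]
    simp only [grp, MonoidAlgebra.coeff_sum, MonoidAlgebra.coeff_smul, Finsupp.finsetSum_apply,
      Finsupp.smul_apply, MonoidAlgebra.coeff_single, Finsupp.single_apply]
    rw [Finset.sum_eq_single 1, Finset.sum_eq_single 1]
    · simp
    · intro r _ hr
      simp [hr]
    · intro h
      exact absurd (Finset.mem_filter.2 ⟨Finset.mem_univ _, fun _ => rfl⟩) h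
    · intro p hp hp1
      refine Finset.sum_eq_zero fun r hr => ?_
      rw [if_neg, smul_zero]
      intro hpr
      have hp' : IsCol n x p := by simpa using hp
      have hr' : IsRow n x r := by simpa using hr
      have : p = r⁻¹ := eq_inv_of_mul_eq_one_left hpr
      exact hp1 (eq_one_of_isRow_of_isCol (this ▸ hr'.inv) hp')
    · intro h
      exact absurd (Finset.mem_filter.2 ⟨Finset.mem_univ _, fun _ => rfl⟩) h
  rw [h0] at h1
  simp at h1

/-- Makes Maschke's theorem available, and with it the complements of submodules used below. -/
instance neZero_card_perm (n : ℕ) : NeZero ((Nat.card (Perm (Fin n)) : ℕ) : ℂ) :=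
  ⟨Nat.cast_ne_zero.2 Nat.card_pos.ne'⟩

/-- Let $c$ be the Young symmetrizer and $N$ a proper submodule of its left ideal. By von Neumann's
lemma $cN\subseteq\mathbb C c$; as $c\notin N$ this forces $cN=0$, hence $N\cdot N=0$. A left ideal
with zero square in a semisimple algebra is zero. -/
theorem isSimpleModule_specht (h : 2 * x ≤ n) :
    IsSimpleModule (MonoidAlgebra ℂ (Perm (Fin n))) (specht n x) := by
  rw [isSimpleModule_iff_isAtom]
  set c := columnAntisymmetrizer n x * rowSymmetrizer n x with hc
  have hspan : specht n x = Submodule.span _ {c} := rfl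
  refine ⟨?_, fun N hN => ?_⟩
  · rw [hspan, Ne, Submodule.span_singleton_eq_bot]
    exact young_ne_zero n x
  have hcN : c ∉ N := fun hcN => hN.not_ge (by
    rw [hspan, Submodule.span_singleton_le_iff_mem]; exact hcN)
  have hann : ∀ s ∈ N, c * s = 0 := by
    intro s hs
    have h1 : s ∈ specht n x := hN.le hs
    rw [hspan, Submodule.mem_span_singleton] at h1
    obtain ⟨y, rfl⟩ := h1
    obtain ⟨z, hz⟩ := exists_smul_of_sandwich h
      (rowSymmetrizer n x * y * columnAntisymmetrizer n x)
    have h2 : c * (y • c) = z • c := by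
      rw [← hz, smul_eq_mul, hc]; simp only [mul_assoc]
    by_cases hz0 : z = 0
    · rw [h2, hz0, zero_smul]
    · refine absurd ?_ hcN
      have h3 : c * (y • c) ∈ N := N.smul_mem c hs
      rw [h2] at h3
      have h4 : algebraMap ℂ (MonoidAlgebra ℂ (Perm (Fin n))) z⁻¹ • (z • c) ∈ N :=
        N.smul_mem _ h3
      rwa [algebraMap_smul, smul_smul, inv_mul_cancel₀ hz0, one_smul] at h4
  have hsq : ∀ s ∈ N, ∀ t ∈ N, s * t = 0 := by
    intro s hs t ht
    have h1 : s ∈ specht n x := hN.le hs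
    rw [hspan, Submodule.mem_span_singleton] at h1
    obtain ⟨y, rfl⟩ := h1
    rw [smul_eq_mul, mul_assoc, hann t ht, mul_zero]
  -- Write $1=e+f$ along a Maschke complement. Then $s=se+sf=sf$ for $s\in N$, so $s$ also lies in
  -- the complement.
  obtain ⟨N', hN'⟩ := exists_isCompl N
  obtain ⟨e, he, f, hf, hef⟩ := Submodule.mem_sup.1
    (hN'.sup_eq_top ▸ Submodule.mem_top : (1 : MonoidAlgebra ℂ (Perm (Fin n))) ∈ N ⊔ N')
  rw [Submodule.eq_bot_iff]
  intro s hs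
  have h1 : s = s * f := by
    conv_lhs => rw [← mul_one s, ← hef, mul_add, hsq s hs e he, zero_add]
  have h2 : s ∈ N' := by
    rw [h1]; exact N'.smul_mem s hf
  have h3 : s ∈ N ⊓ N' := ⟨hs, h2⟩
  rwa [hN'.inf_eq_bot] at h3

end Simple

/-! ### The action on qubits and the operators commuting with it -/

section Action

variable {n : ℕ}

/-- The action of the group algebra on `(ℂ²)^{⊗n}`. -/
noncomputable def act (y : MonoidAlgebra ℂ (Perm (Fin n))) : Qubits n →ₗ[ℂ] Qubits n :=
  (permRep n).asAlgebraHom y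

theorem act_grp (g : Perm (Fin n)) : act (grp g) = permRep n g :=
  Representation.asAlgebraHom_single_one _ _

theorem act_mul (y z : MonoidAlgebra ℂ (Perm (Fin n))) (v : Qubits n) :
    act (y * z) v = act y (act z v) := by
  simp [act]

theorem act_add (y z : MonoidAlgebra ℂ (Perm (Fin n))) (v : Qubits n) :
    act (y + z) v = act y v + act z v := by
  simp [act]

theorem act_smul (r : ℂ) (z : MonoidAlgebra ℂ (Perm (Fin n))) (v : Qubits n) :
    act (r • z) v = r • act z v := by
  simp [act]

theorem act_sum {ι : Type*} (s : Finset ι) (y : ι → MonoidAlgebra ℂ (Perm (Fin n)))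
    (v : Qubits n) : act (∑ i ∈ s, y i) v = ∑ i ∈ s, act (y i) v := by
  simp [act]

theorem permRep_apply (g : Perm (Fin n)) (v : Qubits n) (w : Fin n → Fin 2) :
    permRep n g v w = v (w ∘ g) := rfl

theorem map_act (f : Qubits n →ₗ[ℂ] Qubits n)
    (hf : ∀ g v, f (permRep n g v) = permRep n g (f v))
    (y : MonoidAlgebra ℂ (Perm (Fin n))) (v : Qubits n) : f (act y v) = act y (f v) := by
  induction y using grp_induction with
  | of g => rw [act_grp, hf]
  | add y z hy hz => rw [act_add, act_add, map_add, hy, hz]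
  | smul r y hy => rw [act_smul, act_smul, map_smul, hy]

/-- The number of letters of `w` equal to `1`. -/
def weight (w : Fin n → Fin 2) : ℕ := (Finset.univ.filter fun i => w i = 1).card

theorem weight_comp (w : Fin n → Fin 2) (g : Perm (Fin n)) : weight (w ∘ g) = weight w := by
  refine Finset.card_bij (fun i _ => g i) ?_ ?_ ?_
  · intro i hi; simpa using hi
  · intro i _ j _ hij; exact g.injective hij
  · intro j hj; exact ⟨g⁻¹ j, by simpa using hj, by simp⟩

theorem weight_eq_sum (w : Fin n → Fin 2) : weight w = ∑ i, (w i : ℕ) := by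
  rw [weight, Finset.card_filter]
  refine Finset.sum_congr rfl fun i _ => ?_
  have : ∀ a : Fin 2, (if a = 1 then 1 else 0) = (a : ℕ) := by decide
  exact this _

/-- Words of equal weight form one orbit, so in each weight a vector need only be tested at one
standard word. -/
theorem exists_comp_eq {w w' : Fin n → Fin 2} (h : weight w = weight w') :
    ∃ g : Perm (Fin n), w' ∘ g = w := by
  have e : {i // w i = 1} ≃ {i // w' i = 1} := Fintype.equivOfCardEq (by
    rw [Fintype.card_subtype, Fintype.card_subtype]; exact h)
  refine ⟨e.extendSubtype, ?_⟩
  ext i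
  have h2 : ∀ a b : Fin 2, (a = 1 ↔ b = 1) → (a : ℕ) = b := by decide
  refine h2 _ _ ?_
  by_cases hi : w i = 1
  · simp only [hi, iff_true, Function.comp]
    exact e.extendSubtype_mem i hi
  · simp only [hi, iff_false, Function.comp]
    exact e.extendSubtype_not_mem i hi

/-- The collective lowering operator, `|w⟩ ↦ ∑ |w'⟩` over the words `w'` obtained from `w` by
turning one letter `1` into `0`. -/
noncomputable def lowering (n : ℕ) : Qubits n →ₗ[ℂ] Qubits n where
  toFun v := WithLp.toLp 2 fun w => ∑ a, if w a = 0 then v (Function.update w a 1) else 0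
  map_add' u v := by
    ext w
    simp only [PiLp.add_apply, ← Finset.sum_add_distrib]
    refine Finset.sum_congr rfl fun a _ => ?_
    split_ifs <;> simp
  map_smul' r v := by
    ext w
    simp only [PiLp.smul_apply, RingHom.id_apply, smul_eq_mul, Finset.mul_sum]
    refine Finset.sum_congr rfl fun a _ => ?_
    split_ifs <;> simp

theorem lowering_apply (v : Qubits n) (w : Fin n → Fin 2) :
    lowering n v w = ∑ a, if w a = 0 then v (Function.update w a 1) else 0 := rfl

theorem lowering_permRep (g : Perm (Fin n)) (v : Qubits n) :
    lowering n (permRep n g v) = permRep n g (lowering n v) := by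
  ext w
  rw [permRep_apply, lowering_apply, lowering_apply, ← Equiv.sum_comp g]
  refine Finset.sum_congr rfl fun a _ => ?_
  simp only [Function.comp, permRep_apply]
  refine if_congr Iff.rfl (congrArg (fun w => v w) ?_) rfl
  ext i
  simp [Function.update_apply]

/-- The operator exchanging the letters `0` and `1`. -/
noncomputable def bitFlip (n : ℕ) : Qubits n →ₗ[ℂ] Qubits n where
  toFun v := WithLp.toLp 2 fun w => v fun i => 1 - w i
  map_add' _ _ := rfl
  map_smul' _ _ := rfl

theorem bitFlip_apply (v : Qubits n) (w : Fin n → Fin 2) : bitFlip n v w = v fun i => 1 - w i := rfl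

theorem bitFlip_permRep (g : Perm (Fin n)) (v : Qubits n) :
    bitFlip n (permRep n g v) = permRep n g (bitFlip n v) := rfl

theorem weight_bitFlip (w : Fin n → Fin 2) : weight (fun i => 1 - w i) + weight w = n := by
  rw [weight_eq_sum, weight_eq_sum, ← Finset.sum_add_distrib]
  have : ∀ a : Fin 2, ((1 - a : Fin 2) : ℕ) + a = 1 := by decide
  simp [this]

end Action

end AsymState

/-! ### Only shapes with at most two rows occur; eigenspaces of the class sum -/

namespace AsymState

open Equiv

variable {n : ℕ}

/-- The word whose letters `1` are exactly those in the second row of the tableau. -/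
def secondRow (n m : ℕ) : Fin n → Fin 2 := fun i => if tabRow n m i = 1 then 1 else 0

theorem secondRow_eq_one {m : ℕ} {i : Fin n} : secondRow n m i = 1 ↔ tabRow n m i = 1 := by
  unfold secondRow; split_ifs <;> simp_all

theorem secondRow_eq_zero {m : ℕ} {i : Fin n} : secondRow n m i = 0 ↔ tabRow n m i = 0 := by
  rcases tabRow_eq_zero_or_one (x := m) i with h | h <;> simp [secondRow, h]

theorem weight_secondRow {m : ℕ} (hm : 2 * m ≤ n) : weight (secondRow n m) = m := by
  unfold weight
  simp only [secondRow_eq_one]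
  exact card_tabRow_one hm 1

theorem fin_two_ne_one {a : Fin 2} : a ≠ 1 ↔ a = 0 := by revert a; decide

theorem fin_two_ne_zero {a : Fin 2} : a ≠ 0 ↔ a = 1 := by revert a; decide

/-- The number of letters `0` of `w` in the second row of the tableau. -/
def missing (m : ℕ) (w : Fin n → Fin 2) : ℕ :=
  (Finset.univ.filter fun i => tabRow n m i = 1 ∧ w i = 0).card

theorem card_row_one_one {m : ℕ} (hm : 2 * m ≤ n) (w : Fin n → Fin 2) :
    (Finset.univ.filter fun i => tabRow n m i = 1 ∧ w i = 1).card + missing m w = m := by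
  have h1 := Finset.card_filter_add_card_filter_not
    (s := Finset.univ.filter fun i : Fin n => tabRow n m i = 1) (fun i => w i = 1)
  simp only [Finset.filter_filter, ← ne_eq, fin_two_ne_one] at h1
  rw [show (Finset.univ.filter fun i : Fin n => tabRow n m i = 1).card = m from
    card_tabRow_one hm 1] at h1
  exact h1

theorem card_row_zero_one {m : ℕ} (hm : 2 * m ≤ n) {w : Fin n → Fin 2} (hw : weight w = m) :
    (Finset.univ.filter fun i => tabRow n m i = 0 ∧ w i = 1).card = missing m w := by
  have h1 := Finset.card_filter_add_card_filter_not
    (s := Finset.univ.filter fun i : Fin n => w i = 1) (fun i => tabRow n m i = 1)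
  have h2 : ∀ i : Fin n, ¬ tabRow n m i = 1 ↔ tabRow n m i = 0 := fun i => by
    rcases tabRow_eq_zero_or_one (x := m) i with h | h <;> simp [h]
  simp only [Finset.filter_filter, h2] at h1
  have h3 := card_row_one_one hm w
  simp only [and_comm (a := w _ = 1)] at h1
  rw [show (Finset.univ.filter fun i : Fin n => w i = 1).card = m from hw] at h1
  omega

theorem card_row_zero_zero {m : ℕ} (hm : 2 * m ≤ n) {w : Fin n → Fin 2} (hw : weight w = m) :
    (Finset.univ.filter fun i => tabRow n m i = 0 ∧ w i = 0).card + missing m w + m = n := by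
  have h1 := Finset.card_filter_add_card_filter_not
    (s := Finset.univ.filter fun i : Fin n => tabRow n m i = 0) (fun i => w i = 1)
  simp only [Finset.filter_filter, ← ne_eq, fin_two_ne_one] at h1
  have h2 := Finset.card_filter_add_card_filter_not
    (s := (Finset.univ : Finset (Fin n))) (fun i => tabRow n m i = 1)
  have h3 : ∀ i : Fin n, ¬ tabRow n m i = 1 ↔ tabRow n m i = 0 := fun i => by
    rcases tabRow_eq_zero_or_one (x := m) i with h | h <;> simp [h]
  simp only [h3, Finset.card_univ, Fintype.card_fin] at h2
  rw [show (Finset.univ.filter fun i : Fin n => tabRow n m i = 1).card = m from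
    card_tabRow_one hm 1] at h2
  have h4 := card_row_zero_one hm hw
  omega

theorem eq_secondRow_of_missing_eq_zero {m : ℕ} (hm : 2 * m ≤ n) {w : Fin n → Fin 2}
    (hw : weight w = m) (h0 : missing m w = 0) : w = secondRow n m := by
  have h1 := card_row_zero_one hm hw
  rw [h0, Finset.card_eq_zero, Finset.filter_eq_empty_iff] at h1
  rw [missing, Finset.card_eq_zero, Finset.filter_eq_empty_iff] at h0
  ext i
  congr 1
  rcases tabRow_eq_zero_or_one (x := m) i with h | h
  · rw [secondRow_eq_zero.2 h]
    exact fin_two_ne_one.1 fun e => h1 (Finset.mem_univ i) ⟨h, e⟩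
  · rw [secondRow_eq_one.2 h]
    exact fin_two_ne_zero.1 fun e => h0 (Finset.mem_univ i) ⟨h, e⟩

/-- The amplitudes of a row-invariant vector annihilated by `lowering` alternate in sign with the
number of letters `1` outside the second row. -/
theorem exists_pos_amplitude {m : ℕ} (hm : 2 * m ≤ n) (u : Qubits n)
    (hu : ∀ r, IsRow n m r → permRep n r u = u)
    (hlow : ∀ w, weight w + 1 = m → lowering n u w = 0) (d : ℕ) (hd : d ≤ m) :
    ∃ κ : ℝ, 0 < κ ∧ ∀ w : Fin n → Fin 2, weight w = m → missing m w = d →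
      u w = (-1) ^ d * κ * u (secondRow n m) := by
  induction d with
  | zero =>
    refine ⟨1, one_pos, fun w hw hd => ?_⟩
    rw [eq_secondRow_of_missing_eq_zero hm hw hd]; simp
  | succ d ih =>
    obtain ⟨κ, hκ, ih⟩ := ih (by omega)
    have hpos : (0 : ℝ) < n - m - d := by
      have : m + d < n := by omega
      have : ((m + d : ℕ) : ℝ) < n := by exact_mod_cast this
      push_cast at this
      linarith
    -- Evaluating `lowering n u = 0` at $w$ with one first-row letter `1` erased gives
    -- $(d+1)u_d+(n-m-d)u_{d+1}=0$. Raising one of the $d+1$ zeros in the second row leaves $d$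
    -- missing letters; raising one of the $n-m-d$ zeros in the first row gives $w$ up to a row
    -- permutation.
    refine ⟨(d + 1) * κ / (n - m - d), by positivity, fun w hw hmis => ?_⟩
    obtain ⟨a₀, ha₀⟩ : (Finset.univ.filter fun i => tabRow n m i = 0 ∧ w i = 1).Nonempty := by
      rw [← Finset.card_pos, card_row_zero_one hm hw]; omega
    obtain ⟨hr₀, hw₀⟩ : tabRow n m a₀ = 0 ∧ w a₀ = 1 := by simpa using ha₀
    set w' := Function.update w a₀ 0 with hw'
    have hones : (Finset.univ.filter fun i => w' i = 1) =
        (Finset.univ.filter fun i => w i = 1).erase a₀ := by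
      ext i
      by_cases h : i = a₀
      · subst h; simp [hw']
      · simp [hw', h]
    have hwt : weight w' + 1 = m := by
      rw [weight, hones, Finset.card_erase_add_one (by simpa using hw₀)]; exact hw
    have hrow1 : ∀ a, tabRow n m a = 1 → w' a = w a := fun a ha => by
      rw [hw', Function.update_of_ne]; rintro rfl; omega
    have hsum := hlow w' hwt
    rw [lowering_apply] at hsum
    have hterm : ∀ a, (if w' a = 0 then u (Function.update w' a 1) else 0) =
        (if tabRow n m a = 1 ∧ w a = 0 then (-1) ^ d * κ * u (secondRow n m) else 0) +
        (if (tabRow n m a = 0 ∧ w a = 0) then u w else 0) + if a = a₀ then u w else 0 := by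
      intro a
      by_cases h0 : a = a₀
      · subst h0
        have : Function.update w' a 1 = w := by
          rw [hw', Function.update_idem, ← hw₀, Function.update_eq_self]
        rw [this]
        simp [hw', hw₀]
      have hwa : w' a = w a := by rw [hw', Function.update_of_ne h0]
      rw [hwa, if_neg h0, add_zero]
      by_cases hwa0 : w a = 0
      · rcases tabRow_eq_zero_or_one (x := m) a with h | h
        · simp only [hwa0, h, if_true, and_true]
          have hsw : Function.update w' a 1 = w ∘ swap a a₀ := by
            ext i
            simp only [Function.comp, Function.update_apply, hw', swap_apply_def]
            by_cases h1 : i = a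
            · simp [h1, hw₀]
            · by_cases h2 : i = a₀
              · subst h2; simp [h1, hwa0]
              · simp [h1, h2]
          rw [hsw, ← permRep_apply, hu _ (isRow_swap (h.trans hr₀.symm))]
          simp
        · simp only [hwa0, h, if_true, and_true]
          have hwt2 : weight (Function.update w' a 1) = m := by
            have : (Finset.univ.filter fun i => Function.update w' a 1 i = 1) =
                insert a (Finset.univ.filter fun i => w' i = 1) := by
              ext i
              by_cases h : i = a
              · subst h; simp
              · simp [h]
            rw [weight, this, Finset.card_insert_of_notMem (by simp [hwa, hwa0])]
            exact hwt
          have hmis2 : missing m (Function.update w' a 1) = d := by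
            have : (Finset.univ.filter fun i => tabRow n m i = 1 ∧
                Function.update w' a 1 i = 0) =
                (Finset.univ.filter fun i => tabRow n m i = 1 ∧ w i = 0).erase a := by
              ext i
              by_cases h : i = a
              · subst h; simp
              · by_cases h3 : tabRow n m i = 1
                · simp [h, h3, hrow1 i h3]
                · simp [h3]
            rw [missing, this, Finset.card_erase_of_mem (by simp [h, hwa0])]
            unfold missing at hmis
            omega
          rw [ih _ hwt2 hmis2]
          simp
      · simp [hwa0]
    rw [Finset.sum_congr rfl fun a _ => hterm a, Finset.sum_add_distrib,
      Finset.sum_add_distrib, ← Finset.sum_filter, ← Finset.sum_filter, Finset.sum_const,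
      Finset.sum_const, Finset.sum_ite_eq' , if_pos (Finset.mem_univ _)] at hsum
    have hc1 : (Finset.univ.filter fun i => tabRow n m i = 1 ∧ w i = 0).card = d + 1 := hmis
    have hc2 := card_row_zero_zero hm hw
    rw [hc1] at hsum
    have hc3 : ((Finset.univ.filter fun i => tabRow n m i = 0 ∧ w i = 0).card : ℂ) =
        n - m - d - 1 := by
      rw [hmis] at hc2
      have : (((Finset.univ.filter fun i => tabRow n m i = 0 ∧ w i = 0).card + (d + 1) + m : ℕ)
        : ℂ) = n := by rw [hc2]
      push_cast at this
      linear_combination this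
    rw [nsmul_eq_mul, nsmul_eq_mul, hc3] at hsum
    have hne : (n - m - d : ℂ) ≠ 0 := by
      have : ((n - m - d : ℝ) : ℂ) ≠ 0 := Complex.ofReal_ne_zero.2 hpos.ne'
      simpa using this
    push_cast at hsum ⊢
    field_simp
    linear_combination hsum

/-- Columns have at most two entries, so `p` is an involution, a product of disjoint column
transpositions. Each of them sends exactly one second-row entry to the first row, and `missing`
counts these. -/
theorem sign_of_isCol {m : ℕ} {p : Perm (Fin n)} (hp : IsCol n m p) :
    Perm.sign p = (-1) ^ missing m (secondRow n m ∘ p) := by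
  have hfix : ∀ i, p i = i ↔ tabRow n m (p i) = tabRow n m i := fun i =>
    ⟨fun h => by rw [h], fun h => eq_of_tabRow_tabCol h (hp i)⟩
  have hsq : p ^ 2 = 1 := by
    ext i
    congr 1
    rw [pow_two, Perm.mul_apply, Perm.one_apply]
    by_cases h : p i = i
    · rw [h, h]
    · refine eq_of_tabRow_tabCol ?_ ((hp _).trans (hp _))
      have h1 : p (p i) ≠ p i := fun e => h (p.injective e)
      rw [Ne, hfix] at h1
      rw [hfix] at h
      rcases tabRow_eq_zero_or_one (x := m) i with h2 | h2 <;>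
      rcases tabRow_eq_zero_or_one (x := m) (p i) with h3 | h3 <;>
      rcases tabRow_eq_zero_or_one (x := m) (p (p i)) with h4 | h4 <;> omega
  rw [Perm.sign_of_pow_two_eq_one hsq]
  congr 1
  have h1 : (Fintype.card (Function.fixedPoints p)) + 2 * missing m (secondRow n m ∘ p) =
      Fintype.card (Fin n) := by
    have h2 : Fintype.card (Function.fixedPoints p) =
        (Finset.univ.filter fun i => p i = i).card := by
      rw [← Fintype.card_subtype]
      exact Fintype.card_congr (Equiv.refl _)
    have h3 : ∑ i, tabRow n m (p i) = ∑ i, tabRow n m i := Equiv.sum_comp p _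
    have h4 : ∀ i, (if p i = i then 1 else 0) +
        2 * (if tabRow n m i = 1 ∧ (secondRow n m ∘ p) i = 0 then 1 else 0) + tabRow n m (p i) =
        1 + tabRow n m i := by
      intro i
      simp only [hfix, Function.comp, secondRow_eq_zero]
      rcases tabRow_eq_zero_or_one (x := m) i with h2 | h2 <;>
      rcases tabRow_eq_zero_or_one (x := m) (p i) with h3 | h3 <;> simp [h2, h3]
    have h5 := Finset.sum_congr (s₁ := Finset.univ) rfl fun i _ => h4 i
    rw [Finset.sum_add_distrib, Finset.sum_add_distrib, Finset.sum_add_distrib,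
      ← Finset.mul_sum, ← Finset.card_filter, ← Finset.card_filter, h3] at h5
    simp only [Finset.sum_const, Finset.card_univ, smul_eq_mul, mul_one] at h5
    rw [h2]
    unfold missing
    omega
  omega

/-- The vectors killed by all Young symmetrizers of shapes with at most two rows. -/
def YoungKilled (v : Qubits n) : Prop :=
  ∀ y, 2 * y ≤ n → ∀ g, act (columnAntisymmetrizer n y * rowSymmetrizer n y)
    (permRep n g v) = 0

theorem YoungKilled.map {v : Qubits n} (hv : YoungKilled v) (f : Qubits n →ₗ[ℂ] Qubits n)
    (hf : ∀ g v, f (permRep n g v) = permRep n g (f v)) : YoungKilled (f v) := by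
  intro y hy g
  rw [← hf, ← map_act f hf, hv y hy, map_zero]

theorem act_rowSymmetrizer (m : ℕ) (v : Qubits n) :
    act (rowSymmetrizer n m) v = ∑ r : Perm (Fin n) with IsRow n m r, permRep n r v := by
  rw [rowSymmetrizer_eq, act_sum]
  simp only [act_grp]

theorem act_columnAntisymmetrizer (m : ℕ) (v : Qubits n) :
    act (columnAntisymmetrizer n m) v =
      ∑ p : Perm (Fin n) with IsCol n m p, ((Perm.sign p : ℤ) : ℂ) • permRep n p v := by
  rw [columnAntisymmetrizer_eq, act_sum]
  simp only [act_smul, act_grp]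

theorem secondRow_comp_isRow {m : ℕ} {r : Perm (Fin n)} (hr : IsRow n m r) :
    secondRow n m ∘ r = secondRow n m := by
  ext i
  simp only [Function.comp, secondRow, hr i]

/-- After row symmetrization the amplitudes alternate in sign with `missing`, exactly as the signs
of column permutations do. In the amplitude of the Young symmetrizer at `secondRow` all terms are
thus positive multiples of one number, which must vanish. That number is itself a positive multiple
of `v w`. -/
theorem YoungKilled.apply_eq_zero_of_lowering {m : ℕ} (hm : 2 * m ≤ n) {v : Qubits n}
    (hv : YoungKilled v) (hlow : ∀ w, weight w + 1 = m → lowering n v w = 0)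
    (w : Fin n → Fin 2) (hw : weight w = m) : v w = 0 := by
  obtain ⟨g, rfl⟩ := exists_comp_eq (hw.trans (weight_secondRow hm).symm)
  rw [← permRep_apply]
  set v' := permRep n g v with hv'
  set u := act (rowSymmetrizer n m) v' with hu
  have hlow' : ∀ w, weight w + 1 = m → lowering n u w = 0 := by
    intro w hw
    rw [hu, map_act _ lowering_permRep, hv', lowering_permRep, act_rowSymmetrizer,
      WithLp.ofLp_sum, Finset.sum_apply]
    refine Finset.sum_eq_zero fun r _ => ?_
    rw [permRep_apply, permRep_apply, hlow]
    rw [weight_comp, weight_comp, hw]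
  have hinv : ∀ r, IsRow n m r → permRep n r u = u := by
    intro r hr
    rw [hu, ← act_grp, ← act_mul, grp_mul_rowSymmetrizer hr]
  have hamp := fun d hd => exists_pos_amplitude hm u hinv hlow' d hd
  choose κ hκ hamp using hamp
  have hle : ∀ w' : Fin n → Fin 2, missing m w' ≤ m := fun w' => by
    have := card_row_one_one hm w'; omega
  have hzero : act (columnAntisymmetrizer n m) u (secondRow n m) = 0 := by
    rw [hu, ← act_mul, hv', hv m hm g]; rfl
  rw [act_columnAntisymmetrizer, WithLp.ofLp_sum, Finset.sum_apply] at hzero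
  have hterm : ∀ p ∈ Finset.univ.filter (IsCol n m),
      (((Perm.sign p : ℤ) : ℂ) • permRep n p u) (secondRow n m) =
        (κ _ (hle (secondRow n m ∘ p)) : ℂ) * u (secondRow n m) := by
    intro p hp
    have hp' : IsCol n m p := by simpa using hp
    rw [PiLp.smul_apply, permRep_apply, sign_of_isCol hp',
      hamp _ (hle _) _ ((weight_comp _ _).trans (weight_secondRow hm)) rfl, smul_eq_mul]
    have h1 : ((-1 : ℂ) ^ missing m (secondRow n m ∘ p)) ^ 2 = 1 := by
      rw [← pow_mul, mul_comm, pow_mul]; simp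
    push_cast
    linear_combination (κ _ (hle (secondRow n m ∘ p)) : ℂ) * u (secondRow n m) * h1
  rw [Finset.sum_congr rfl hterm, ← Finset.sum_mul, ← Complex.ofReal_sum] at hzero
  have hpos : 0 < ∑ p ∈ Finset.univ.filter (IsCol n m), κ _ (hle (secondRow n m ∘ p)) :=
    Finset.sum_pos (fun p _ => hκ _ _)
      ⟨1, Finset.mem_filter.2 ⟨Finset.mem_univ _, fun _ => rfl⟩⟩
  have hu0 : u (secondRow n m) = 0 :=
    (mul_eq_zero.1 hzero).resolve_left (Complex.ofReal_ne_zero.2 hpos.ne')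
  rw [hu, act_rowSymmetrizer, WithLp.ofLp_sum, Finset.sum_apply,
    Finset.sum_congr rfl fun r hr => by
      rw [permRep_apply, secondRow_comp_isRow (by simpa using hr)],
    Finset.sum_const, nsmul_eq_mul] at hu0
  refine (mul_eq_zero.1 hu0).resolve_left (Nat.cast_ne_zero.2 ?_)
  exact Finset.card_ne_zero_of_mem (Finset.mem_filter.2 ⟨Finset.mem_univ 1, fun _ => rfl⟩)

/-- Lowering commutes with permutations, so the lowered vector is killed too; by induction its part
of weight $m-1$ vanishes, which is the hypothesis needed in weight $m$. -/
theorem YoungKilled.apply_eq_zero {m : ℕ} (hm : 2 * m ≤ n) {v : Qubits n}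
    (hv : YoungKilled v) (w : Fin n → Fin 2) (hw : weight w = m) : v w = 0 := by
  induction m generalizing v w with
  | zero => exact hv.apply_eq_zero_of_lowering hm (fun w hw => by omega) w hw
  | succ m ih =>
    exact hv.apply_eq_zero_of_lowering hm
      (fun w hw => ih (by omega) (hv.map _ lowering_permRep) w (by omega)) w hw

/-- Every nonzero vector is moved to a nonzero one by some Young symmetrizer of a shape with at
most two rows. -/
theorem YoungKilled.eq_zero {v : Qubits n} (hv : YoungKilled v) : v = 0 := by
  ext w
  by_cases h : 2 * weight w ≤ n
  · exact hv.apply_eq_zero h w rfl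
  · have h1 := weight_bitFlip w
    have h2 := (hv.map _ bitFlip_permRep).apply_eq_zero (m := weight fun i => 1 - w i)
      (by omega) (fun i => 1 - w i) rfl
    rw [bitFlip_apply] at h2
    simpa using h2

/-- The eigenspace of `swapSum n` for the eigenvalue `swapEig n x`. -/
noncomputable def swapSpace (n x : ℕ) : Submodule ℂ (Qubits n) :=
  Module.End.eigenspace (act (swapSum n)) (swapEig n x)

theorem mem_swapSpace {x : ℕ} {v : Qubits n} :
    v ∈ swapSpace n x ↔ act (swapSum n) v = swapEig n x • v :=
  Module.End.mem_eigenspace_iff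

/-- The difference of two eigenvalues has the factors $x-y$ and $n+1-x-y$, and the second is
positive when $2x,2y\le n$. -/
theorem swapEig_injOn {x y : ℕ} (hx : 2 * x ≤ n) (hy : 2 * y ≤ n)
    (h : swapEig n x = swapEig n y) : x = y := by
  have h1 : ((x : ℂ) - y) * (n + 1 - x - y) = 0 := by
    unfold swapEig at h
    linear_combination (-1 / 2) * h
  rcases mul_eq_zero.1 h1 with h2 | h2
  · exact_mod_cast sub_eq_zero.1 h2
  · have h3 : ((n + 1 : ℕ) : ℂ) = ((x + y : ℕ) : ℂ) := by push_cast; linear_combination h2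
    have := Nat.cast_injective h3
    omega

theorem act_mem_swapSpace {x : ℕ} {v : Qubits n} (hv : v ∈ swapSpace n x)
    (y : MonoidAlgebra ℂ (Perm (Fin n))) : act y v ∈ swapSpace n x := by
  rw [mem_swapSpace] at hv ⊢
  rw [← act_mul, swapSum_comm, act_mul, hv, map_smul]

theorem act_young_mem_swapSpace {x : ℕ} (hx : 2 * x ≤ n) (v : Qubits n) :
    act (columnAntisymmetrizer n x * rowSymmetrizer n x) v ∈ swapSpace n x := by
  rw [mem_swapSpace, ← act_mul, swapSum_mul_young hx, act_smul]

/-- The Young symmetrizer of another shape annihilates `swapSpace n x`. -/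
theorem act_young_eq_zero {x y : ℕ} (hx : 2 * x ≤ n) (hy : 2 * y ≤ n) (hne : y ≠ x)
    {v : Qubits n} (hv : v ∈ swapSpace n x) :
    act (columnAntisymmetrizer n y * rowSymmetrizer n y) v = 0 := by
  have h1 := mem_swapSpace.1 (act_mem_swapSpace hv
    (columnAntisymmetrizer n y * rowSymmetrizer n y))
  rw [mem_swapSpace.1 (act_young_mem_swapSpace hy v), ← sub_eq_zero, ← sub_smul] at h1
  exact (smul_eq_zero.1 h1).resolve_left (sub_ne_zero.2 fun e => hne (swapEig_injOn hy hx e))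

end AsymState

/-! ### Isotypical components as eigenspaces, and their projectors -/

namespace AsymState

open Equiv

variable {n : ℕ}

theorem mem_isotypical {x : ℕ} {v : Qubits n} :
    v ∈ isotypical n x ↔ (permRep n).asModuleEquiv.symm v ∈
      isotypicComponent (MonoidAlgebra ℂ (Perm (Fin n))) (permRep n).asModule (specht n x) :=
  Iff.rfl

theorem asModuleEquiv_symm_act (y : MonoidAlgebra ℂ (Perm (Fin n))) (v : Qubits n) :
    (permRep n).asModuleEquiv.symm (act y v) = y • (permRep n).asModuleEquiv.symm v := by
  apply (permRep n).asModuleEquiv.injective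
  rw [Representation.asModuleEquiv_map_smul, LinearEquiv.apply_symm_apply,
    LinearEquiv.apply_symm_apply]
  rfl

/-- The vector is the image of the Young symmetrizer under the module map $y\mapsto y\cdot v$, which
sends the simple module `specht n x` into the isotypical component. -/
theorem act_young_mem_isotypical {x : ℕ} (hx : 2 * x ≤ n) (v : Qubits n) :
    act (columnAntisymmetrizer n x * rowSymmetrizer n x) v ∈ isotypical n x := by
  have := isSimpleModule_specht hx
  rw [mem_isotypical, asModuleEquiv_symm_act]
  exact Submodule.map_le_isotypicComponent (specht n x)
    (LinearMap.toSpanSingleton _ (permRep n).asModule ((permRep n).asModuleEquiv.symm v))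
    (Submodule.mem_map_of_mem (Submodule.mem_span_singleton_self _))

/-- The class sum minus its eigenvalue is central and kills the Specht module, hence every submodule
isomorphic to it. -/
theorem isotypical_le_swapSpace {x : ℕ} (hx : 2 * x ≤ n) : isotypical n x ≤ swapSpace n x := by
  set t : MonoidAlgebra ℂ (Perm (Fin n)) :=
    swapSum n - algebraMap ℂ (MonoidAlgebra ℂ (Perm (Fin n))) (swapEig n x) with ht
  have hcomm : ∀ y, t * y = y * t := fun y => by
    rw [ht, sub_mul, mul_sub, swapSum_comm, Algebra.commutes]
  have hspecht : ∀ s ∈ specht n x, t * s = 0 := by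
    intro s hs
    obtain ⟨y, rfl⟩ := Submodule.mem_span_singleton.1 hs
    rw [smul_eq_mul, ← mul_assoc, hcomm, mul_assoc, ht, sub_mul, swapSum_mul_young hx,
      ← Algebra.smul_def, sub_self, mul_zero]
  let E : Submodule (MonoidAlgebra ℂ (Perm (Fin n))) (permRep n).asModule :=
    { carrier := {v | t • v = 0}
      add_mem' := fun {a b} ha hb => by
        change t • (a + b) = 0
        rw [smul_add, show t • a = 0 from ha, show t • b = 0 from hb, add_zero]
      zero_mem' := smul_zero t
      smul_mem' := fun y v hv => by
        change t • y • v = 0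
        rw [← mul_smul, hcomm, mul_smul, show t • v = 0 from hv, smul_zero] }
  have h1 : isotypicComponent (MonoidAlgebra ℂ (Perm (Fin n))) (permRep n).asModule
      (specht n x) ≤ E := by
    refine sSup_le ?_
    rintro S ⟨e⟩ v hv
    obtain ⟨s, hs⟩ := e.symm.surjective ⟨v, hv⟩
    change t • v = 0
    have h2 : t • s = 0 := Subtype.ext (hspecht s s.2)
    have h3 : t • (⟨v, hv⟩ : S) = 0 := by rw [← hs, ← map_smul, h2, map_zero]
    exact congrArg Subtype.val h3
  intro v hv
  have h2 : t • (permRep n).asModuleEquiv.symm v = 0 := h1 hv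
  rw [← asModuleEquiv_symm_act, LinearEquiv.map_eq_zero_iff, ht] at h2
  rw [mem_swapSpace, ← sub_eq_zero, ← h2]
  simp [act, Algebra.algebraMap_eq_smul_one]

/-- Split an eigenvector along a Maschke complement of the isotypical component and let $q$ be its
part in the complement. Symmetrizers of other shapes kill $q$ by its eigenvalue; that of shape
$(n-x,x)$ sends $q$ into both the component and its complement. So $q$ is killed by all of them and
vanishes. -/
theorem isotypical_eq_swapSpace {x : ℕ} (hx : 2 * x ≤ n) : isotypical n x = swapSpace n x := by
  refine le_antisymm (isotypical_le_swapSpace hx) fun v hv => ?_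
  obtain ⟨N, hN⟩ := exists_isCompl (isotypicComponent (MonoidAlgebra ℂ (Perm (Fin n)))
    (permRep n).asModule (specht n x))
  obtain ⟨p, hp, q, hq, hpq⟩ := Submodule.mem_sup.1
    (hN.sup_eq_top ▸ Submodule.mem_top (x := (permRep n).asModuleEquiv.symm v))
  have hpE : (permRep n).asModuleEquiv p ∈ swapSpace n x := isotypical_le_swapSpace hx hp
  have hqE : (permRep n).asModuleEquiv q ∈ swapSpace n x := by
    have h1 : (permRep n).asModuleEquiv q = v - (permRep n).asModuleEquiv p := by
      rw [← LinearEquiv.apply_symm_apply (permRep n).asModuleEquiv v, ← hpq, map_add]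
      exact (add_sub_cancel_left _ _).symm
    rw [h1]
    exact (swapSpace n x).sub_mem hv hpE
  have hkill : YoungKilled ((permRep n).asModuleEquiv q) := by
    intro y hy g
    by_cases hyx : y = x
    · subst hyx
      have h1 := act_young_mem_isotypical hx (permRep n g ((permRep n).asModuleEquiv q))
      rw [mem_isotypical] at h1
      have h2 : (permRep n).asModuleEquiv.symm
          (act (columnAntisymmetrizer n y * rowSymmetrizer n y)
            (permRep n g ((permRep n).asModuleEquiv q))) ∈ N := by
        rw [asModuleEquiv_symm_act, ← act_grp, asModuleEquiv_symm_act,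
          LinearEquiv.symm_apply_apply]
        exact N.smul_mem _ (N.smul_mem _ hq)
      have h3 := Submodule.mem_inf.2 ⟨h1, h2⟩
      rw [hN.inf_eq_bot, Submodule.mem_bot, LinearEquiv.map_eq_zero_iff] at h3
      exact h3
    · rw [← act_grp]
      exact act_young_eq_zero hx hy hyx (act_mem_swapSpace hqE _)
  have h0 := hkill.eq_zero
  rw [LinearEquiv.map_eq_zero_iff] at h0
  rw [mem_isotypical, ← hpq, h0, add_zero]
  exact hp

theorem inner_eq_sum (u v : Qubits n) :
    inner ℂ u v = ∑ w, v w * starRingEnd ℂ (u w) := by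
  simp [PiLp.inner_apply]

theorem inner_permRep (g : Perm (Fin n)) (u v : Qubits n) :
    inner ℂ (permRep n g u) (permRep n g v) = inner ℂ u v := by
  rw [inner_eq_sum, inner_eq_sum]
  exact Equiv.sum_comp (Equiv.arrowCongr g⁻¹ (Equiv.refl (Fin 2)))
    fun w => v w * starRingEnd ℂ (u w)

/-- Transpositions act by unitary involutions, hence the class sum is self-adjoint. -/
theorem inner_act_swapSum (u v : Qubits n) :
    inner ℂ (act (swapSum n) u) v = inner ℂ u (act (swapSum n) v) := by
  simp only [swapSum, act_sum, sum_inner, inner_sum, act_grp]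
  refine Finset.sum_congr rfl fun i _ => Finset.sum_congr rfl fun j _ => ?_
  rw [← inner_permRep (swap i j)]
  congr 1
  rw [← Module.End.mul_apply, ← map_mul, swap_mul_self, map_one, Module.End.one_apply]

theorem conj_swapEig (x : ℕ) : starRingEnd ℂ (swapEig n x) = swapEig n x := by
  simp only [swapEig, map_sub, map_mul, map_pow, map_add, map_natCast, map_one, map_ofNat]

/-- The eigenspaces of `swapSum n` are pairwise orthogonal. -/
theorem inner_eq_zero_of_mem_swapSpace {x y : ℕ} (hx : 2 * x ≤ n) (hy : 2 * y ≤ n) (hne : x ≠ y)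
    {u v : Qubits n} (hu : u ∈ swapSpace n x) (hv : v ∈ swapSpace n y) : inner ℂ u v = 0 := by
  have h1 := inner_act_swapSum u v
  rw [mem_swapSpace.1 hu, mem_swapSpace.1 hv, inner_smul_left, inner_smul_right, conj_swapEig,
    ← sub_eq_zero, ← sub_mul] at h1
  exact (mul_eq_zero.1 h1).resolve_left (sub_ne_zero.2 fun e => hne (swapEig_injOn hx hy e))

theorem projector_permRep {x : ℕ} (hx : 2 * x ≤ n) (g : Perm (Fin n)) (v : Qubits n) :
    projector n x (permRep n g v) = permRep n g (projector n x v) := by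
  unfold projector
  refine (Submodule.eq_starProjection_of_mem_of_inner_eq_zero ?_ fun w hw => ?_)
  · have h1 := Submodule.starProjection_apply_mem (isotypical n x) v
    have h2 := act_mem_swapSpace ((isotypical_eq_swapSpace hx).le h1) (grp g)
    rw [act_grp] at h2
    exact (isotypical_eq_swapSpace hx).ge h2
  · have h1 : permRep n g⁻¹ w ∈ isotypical n x := by
      rw [isotypical_eq_swapSpace hx] at hw ⊢
      rw [← act_grp]
      exact act_mem_swapSpace hw _
    have h2 : w = permRep n g (permRep n g⁻¹ w) := by
      rw [← Module.End.mul_apply, ← map_mul, mul_inv_cancel, map_one, Module.End.one_apply]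
    rw [← map_sub, h2, inner_permRep]
    exact Submodule.starProjection_inner_eq_zero _ _ h1

/-- A vector whose translates are all annihilated by the column antisymmetrizer of shape
`(n-x, x)` is orthogonal to the isotypical component. -/
theorem projector_eq_zero {x : ℕ} (hx : 2 * x ≤ n) {v : Qubits n}
    (hv : ∀ g, act (columnAntisymmetrizer n x) (permRep n g v) = 0) : projector n x v = 0 := by
  have hmem : projector n x v ∈ swapSpace n x := by
    rw [← isotypical_eq_swapSpace hx]
    exact Submodule.starProjection_apply_mem _ _
  refine YoungKilled.eq_zero fun y hy g => ?_
  by_cases hyx : y = x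
  · subst hyx
    have hcomm := map_act (projector n y : Qubits n →ₗ[ℂ] Qubits n)
      (fun g v => projector_permRep hx g v)
    simp only [ContinuousLinearMap.coe_coe] at hcomm
    -- For the shape itself, the Young symmetrizer commutes past the projector and then meets only
    -- column-antisymmetrized translates of `v`, all zero.
    rw [← projector_permRep hx, ← hcomm, act_mul, act_rowSymmetrizer, map_sum,
      Finset.sum_eq_zero, map_zero]
    intro r _
    rw [← Module.End.mul_apply (permRep n r), ← map_mul, hv]
  · rw [← act_grp]
    exact act_young_eq_zero hx hy hyx (act_mem_swapSpace hmem _)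

theorem act_columnAntisymmetrizer_eq_zero {x : ℕ} {v : Qubits n} {i j : Fin n} (hij : i ≠ j)
    (hc : tabCol n x i = tabCol n x j) (hv : permRep n (swap i j) v = v) :
    act (columnAntisymmetrizer n x) v = 0 := by
  have h1 : act (columnAntisymmetrizer n x) v = -act (columnAntisymmetrizer n x) v := by
    conv_lhs => rw [← hv, ← act_grp, ← act_mul, columnAntisymmetrizer_mul_grp (isCol_swap hc),
      Perm.sign_swap hij, act_smul]
    simp
  have h2 : (2 : ℂ) • act (columnAntisymmetrizer n x) v = 0 := by
    rw [two_smul]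
    nth_rewrite 2 [h1]
    exact add_neg_cancel _
  exact (smul_eq_zero.1 h2).resolve_left two_ne_zero

end AsymState

/-! ### Amplitudes of $\Xi$ and the support of $p$ -/

namespace AsymState

open Equiv

variable {n : ℕ}

theorem ket_apply (f w : Fin n → Fin 2) : ket f w = if w = f then 1 else 0 := by
  rw [ket, PiLp.single_apply]

theorem dicke_apply (r s : ℕ) (w : Fin r → Fin 2) :
    dicke r s w = if weight w = s then ((Real.sqrt (r.choose s : ℝ) : ℂ))⁻¹ else 0 := by
  rw [dicke, PiLp.smul_apply, WithLp.ofLp_sum, Finset.sum_apply]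
  simp only [ket_apply, Finset.sum_ite_eq, Finset.mem_filter, Finset.mem_univ, true_and,
    smul_eq_mul, mul_ite, mul_one, mul_zero]
  rfl

/-- The words occurring in `|Ξ_{n,m|k,l}⟩`. -/
def IsXiWord (m k l : ℕ) (w : Fin n → Fin 2) : Prop :=
  (∀ i : Fin n, (i : ℕ) < k → w i = if (i : ℕ) < l then 1 else 0) ∧ weight w = m

instance (m k l : ℕ) : DecidablePred (IsXiWord (n := n) m k l) := fun w => by
  unfold IsXiWord; infer_instance

theorem weight_eq_add {k : ℕ} (hk : k ≤ n) (w : Fin n → Fin 2) :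
    weight w = weight (fun i : Fin k => w ⟨i, lt_of_lt_of_le i.2 hk⟩) +
      weight (fun j : Fin (n - k) => w ⟨k + j, by have := j.2; omega⟩) := by
  obtain ⟨r, rfl⟩ := Nat.exists_eq_add_of_le hk
  simp only [weight_eq_sum]
  rw [Fin.sum_univ_add]
  congr 1
  exact (Equiv.sum_comp (finCongr (Nat.add_sub_cancel_left (n := k) (m := r)))
    fun j : Fin r => ((w (Fin.natAdd k j) : Fin 2) : ℕ)).symm

theorem weight_onesZeros {k l : ℕ} (hlk : l ≤ k) :
    weight (fun i : Fin k => if (i : ℕ) < l then (1 : Fin 2) else 0) = l := by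
  have : (Finset.univ.filter fun i : Fin k => (if (i : ℕ) < l then (1 : Fin 2) else 0) = 1) =
      Finset.univ.filter fun i : Fin k => (i : ℕ) < l :=
    Finset.filter_congr fun i _ => by split_ifs <;> simp_all
  rw [weight, this, Fin.card_filter_val_lt, min_eq_right hlk]

theorem stateXi_apply {m k l : ℕ} (hk : k ≤ n) (hlm : l ≤ m) (hlk : l ≤ k)
    (w : Fin n → Fin 2) : stateXi n m k l hk w =
      if IsXiWord m k l w then ((Real.sqrt ((n - k).choose (m - l) : ℝ) : ℂ))⁻¹ else 0 := by
  change onesZeros k l _ * dicke (n - k) (m - l) _ = _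
  rw [onesZeros, ket_apply, dicke_apply]
  have h1 : (fun i : Fin k => w ⟨i, lt_of_lt_of_le i.2 hk⟩) =
      (fun i : Fin k => if (i : ℕ) < l then (1 : Fin 2) else 0) ↔
      ∀ i : Fin n, (i : ℕ) < k → w i = if (i : ℕ) < l then 1 else 0 := by
    rw [funext_iff]
    exact ⟨fun h i hi => h ⟨i, hi⟩, fun h i => h ⟨i, _⟩ i.2⟩
  by_cases h2 : (fun i : Fin k => w ⟨i, lt_of_lt_of_le i.2 hk⟩) =
      (fun i : Fin k => if (i : ℕ) < l then (1 : Fin 2) else 0)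
  · have h3 := weight_eq_add hk w
    rw [h2, weight_onesZeros hlk] at h3
    rw [if_pos h2, one_mul]
    refine if_congr ?_ rfl rfl
    rw [IsXiWord, ← h1]
    constructor
    · intro h; exact ⟨h2, by omega⟩
    · rintro ⟨-, h⟩; omega
  · rw [if_neg h2, zero_mul, if_neg fun h => h2 (h1.2 h.1)]

theorem eq_sum_ket (v : Qubits n) : v = ∑ w, v w • ket w := by
  ext w
  rw [WithLp.ofLp_sum, Finset.sum_apply]
  simp [ket_apply]

/-- A word with different letters in each of the `x` two-element columns has at least `x` ones and
`x` zeros. Any other word is fixed by some column transposition. -/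
theorem act_columnAntisymmetrizer_weight {x m : ℕ} (hx : 2 * x ≤ n) (hm : m < x ∨ n < m + x)
    {v : Qubits n} (hv : ∀ w, v w ≠ 0 → weight w = m) :
    act (columnAntisymmetrizer n x) v = 0 := by
  rw [eq_sum_ket v, map_sum]
  refine Finset.sum_eq_zero fun w _ => ?_
  rw [map_smul]
  by_cases h0 : v w = 0
  · rw [h0, zero_smul]
  have hw := hv w h0
  obtain ⟨c, hc⟩ : ∃ c : Fin x, w (lo hx c) = w (hi hx c) := by
    by_contra! hcon
    rcases hm with hm | hm
    · have := card_ge_of_meets_columns hx (Finset.univ.filter fun i => w i = 1) fun c => by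
        have h1 := hcon c
        simp only [Finset.mem_filter, Finset.mem_univ, true_and]
        generalize w (lo hx c) = a at *
        generalize w (hi hx c) = b at *
        revert a b; decide
      unfold weight at hw
      omega
    · have := card_ge_of_meets_columns hx (Finset.univ.filter fun i => ¬ w i = 1) fun c => by
        have h1 := hcon c
        simp only [Finset.mem_filter, Finset.mem_univ, true_and]
        generalize w (lo hx c) = a at *
        generalize w (hi hx c) = b at *
        revert a b; decide
      have h2 := Finset.card_filter_add_card_filter_not (s := Finset.univ) (fun i => w i = 1)
      unfold weight at hw
      rw [Finset.card_univ, Fintype.card_fin] at h2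
      omega
  rw [act_columnAntisymmetrizer_eq_zero (i := lo hx c) (j := hi hx c), smul_zero]
  · intro e
    have := tabRow_lo hx c
    rw [e, tabRow_hi] at this
    omega
  · rw [tabCol_lo, tabCol_hi]
  · rw [permRep_ket, swap_inv]
    congr 1
    ext i
    simp only [Function.comp, swap_apply_def]
    split_ifs with h1 h2
    · rw [h1, hc]
    · rw [h2, hc]
    · rfl

theorem weight_of_stateXi_ne_zero {m k l : ℕ} (hk : k ≤ n) (hlm : l ≤ m) (hlk : l ≤ k)
    {w : Fin n → Fin 2} (h : stateXi n m k l hk w ≠ 0) : weight w = m := by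
  rw [stateXi_apply hk hlm hlk] at h
  by_contra hw
  exact h (if_neg fun h1 => hw h1.2)

theorem permRep_swap_stateXi {m k l : ℕ} (hk : k ≤ n) (hlm : l ≤ m) (hlk : l ≤ k) {i j : Fin n}
    (hi : k ≤ i) (hj : k ≤ j) :
    permRep n (swap i j) (stateXi n m k l hk) = stateXi n m k l hk := by
  ext w
  rw [permRep_apply, stateXi_apply hk hlm hlk, stateXi_apply hk hlm hlk]
  refine if_congr ?_ rfl rfl
  unfold IsXiWord
  rw [weight_comp]
  refine and_congr_left fun _ => forall_congr' fun a => forall_congr' fun ha => ?_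
  rw [Function.comp, swap_apply_of_ne_of_ne]
  · rintro rfl; omega
  · rintro rfl; omega

theorem pmf_eq_zero {m k l x : ℕ} (hk : k ≤ n) (hlm : l ≤ m)
    (hlk : l ≤ k) (hx : 2 * x ≤ n) (h : min (min m (n - m)) k < x) :
    pmf n m k l hk x = 0 := by
  have h0 : projector n x (stateXi n m k l hk) = 0 := by
    refine projector_eq_zero hx fun g => ?_
    by_cases hkx : k < x
    -- Fewer than `x` positions come from the first `k`, so they cannot meet every column. Some
    -- column comes entirely from the tail, on which $\Xi$ is symmetric.
    · obtain ⟨c, hc1, hc2⟩ : ∃ c : Fin x, k ≤ (g⁻¹ (lo hx c) : Fin n) ∧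
          k ≤ (g⁻¹ (hi hx c) : Fin n) := by
        by_contra! hcon
        have h1 := card_ge_of_meets_columns hx
          (Finset.univ.filter fun i => ((g⁻¹ i : Fin n) : ℕ) < k) fun c => by
            simp only [Finset.mem_filter, Finset.mem_univ, true_and]
            by_cases h2 : k ≤ (g⁻¹ (lo hx c) : Fin n)
            · exact Or.inr (hcon c h2)
            · exact Or.inl (by omega)
        have h2 : (Finset.univ.filter fun i => ((g⁻¹ i : Fin n) : ℕ) < k).card ≤ k := by
          have h3 : (Finset.univ.filter fun i => ((g⁻¹ i : Fin n) : ℕ) < k).card ≤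
              (Finset.univ.filter fun i : Fin n => (i : ℕ) < k).card :=
            Finset.card_le_card_of_injOn (fun i => g⁻¹ i) (fun i hi => by simpa using hi)
              g⁻¹.injective.injOn
          rw [Fin.card_filter_val_lt] at h3
          omega
        omega
      refine act_columnAntisymmetrizer_eq_zero (i := lo hx c) (j := hi hx c) ?_
        ((tabCol_lo hx c).trans (tabCol_hi hx c).symm) ?_
      · intro e
        have := tabRow_lo hx c
        rw [e, tabRow_hi] at this
        omega
      · have h1 : swap (lo hx c) (hi hx c) * g =
            g * swap (g⁻¹ (lo hx c)) (g⁻¹ (hi hx c)) := by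
          rw [mul_swap_eq_swap_mul]; simp
        rw [← Module.End.mul_apply, ← map_mul, h1, map_mul, Module.End.mul_apply,
          permRep_swap_stateXi hk hlm hlk hc1 hc2]
    · refine act_columnAntisymmetrizer_weight hx (m := m) (by omega) fun w hw => ?_
      rw [permRep_apply] at hw
      rw [← weight_of_stateXi_ne_zero hk hlm hlk hw, weight_comp]
  rw [pmf, h0, inner_zero_right, Complex.zero_re]

end AsymState

/-! ### Hahn and Racah sums: summation formula and difference equation -/

namespace AsymState

/-- The falling factorial `y (y - 1) ⋯ (y - i + 1)`. -/
noncomputable def fall (y : ℝ) (i : ℕ) : ℝ := ∏ j ∈ Finset.range i, (y - j)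

theorem fall_zero (y : ℝ) : fall y 0 = 1 := rfl

theorem fall_succ (y : ℝ) (i : ℕ) : fall y (i + 1) = fall y i * (y - i) :=
  Finset.prod_range_succ _ _

theorem fall_succ' (y : ℝ) (i : ℕ) : fall y (i + 1) = y * fall (y - 1) i := by
  unfold fall
  rw [Finset.prod_range_succ', mul_comm]
  congr 1
  · simp
  · exact Finset.prod_congr rfl fun j _ => by push_cast; ring

theorem fall_shift (y : ℝ) (i : ℕ) : y * fall (y - 1) i = fall y i * (y - i) := by
  rw [← fall_succ', fall_succ]

theorem fall_eq_zero {x i : ℕ} (h : x < i) : fall x i = 0 :=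
  Finset.prod_eq_zero (Finset.mem_range.2 h) (sub_self _)

theorem fall_pos {x i : ℕ} (h : i ≤ x) : 0 < fall x i :=
  Finset.prod_pos fun j hj => sub_pos.2 (by
    exact_mod_cast (Finset.mem_range.1 hj).trans_le h)

/-- The dimension of the Specht module of shape `(n-x, x)`. -/
noncomputable def spechtDim (n x : ℕ) : ℝ :=
  (n.choose x : ℝ) * (n - 2 * x + 1) / (n - x + 1)

/-- Telescopes in $m$: the term $x=m+1$ is the difference of the right-hand sides for $m+1$ and $m$.
For $i=0$ it says that the two-row dimensions up to $m$ add up to $\binom nm$. -/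
theorem sum_spechtDim_mul_fall {n m : ℕ} (hm : m ≤ n) (i : ℕ) :
    ∑ x ∈ Finset.range (m + 1), spechtDim n x * (fall x i * fall (n + 1 - x) i) =
      n.choose m * (fall m i * fall (n - m) i) := by
  induction m with
  | zero =>
    have hn : (n : ℝ) + 1 ≠ 0 := by positivity
    cases i with
    | zero => simp [spechtDim, fall_zero, hn]
    | succ i => simp [fall_succ']
  | succ m ih =>
    rw [Finset.sum_range_succ, ih (by omega)]
    have hnm : (n : ℝ) - m ≠ 0 := by
      have : (m : ℝ) < n := by exact_mod_cast hm
      linarith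
    have h1 : (n.choose (m + 1) : ℝ) * (m + 1) = n.choose m * (n - m) := by
      have := Nat.choose_succ_right_eq n m
      have h2 : ((n.choose (m + 1) * (m + 1) : ℕ) : ℝ) = (n.choose m * (n - m) : ℕ) := by rw [this]
      rw [Nat.cast_mul, Nat.cast_mul, Nat.cast_sub (by omega)] at h2
      push_cast at h2
      exact h2
    have h2 := fall_shift ((m : ℝ) + 1) i
    have h3 := fall_shift ((n : ℝ) - m) i
    rw [add_sub_cancel_right] at h2
    have e1 : (n : ℝ) + 1 - ((m + 1 : ℕ) : ℝ) = n - m := by push_cast; ring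
    have e2 : (n : ℝ) - ((m + 1 : ℕ) : ℝ) = n - m - 1 := by push_cast; ring
    rw [spechtDim, e1, e2]
    push_cast
    have hden : (n : ℝ) - m - 1 + 1 = n - m := by ring
    rw [hden]
    field_simp
    have hm1 : (m : ℝ) + 1 ≠ 0 := by positivity
    have h4 : fall (m : ℝ) i = fall (m + 1) i * (m + 1 - i) / (m + 1) := by
      field_simp; linear_combination h2
    have h5 : fall ((n : ℝ) - m - 1) i = fall (n - m) i * (n - m - i) / (n - m) := by
      field_simp; linear_combination h3
    have h6 : (n.choose m : ℝ) = n.choose (m + 1) * (m + 1) / (n - m) := by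
      field_simp; linear_combination -h1
    rw [h4, h5, h6]
    field_simp
    ring

/-- The coefficient of the `i`-th distance vector in the isotypical component of shape
`(n-x, x)`. -/
noncomputable def hahnCoeff (n m : ℕ) (x : ℝ) (i : ℕ) : ℝ :=
  (-1) ^ i * (fall x i * fall (n + 1 - x) i) / (fall m i * fall (n - m) i)

theorem fall_mul_fall_ne_zero {n m i : ℕ} (hm : 2 * m ≤ n) (hi : i ≤ m) :
    fall m i * fall (n - m) i ≠ 0 := by
  have h1 := fall_pos hi
  have h2 := fall_pos (x := n - m) (i := i) (by omega)
  rw [Nat.cast_sub (by omega)] at h2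
  positivity

theorem hahnCoeff_succ {n m i : ℕ} (hm : 2 * m ≤ n) (hi : i < m) (x : ℝ) :
    hahnCoeff n m x (i + 1) * ((m - i) * (n - m - i)) =
      -(hahnCoeff n m x i * ((x - i) * (n + 1 - x - i))) := by
  have h1 := fall_mul_fall_ne_zero hm hi.le
  have h2 := fall_mul_fall_ne_zero hm hi
  unfold hahnCoeff
  simp only [fall_succ] at h2 ⊢
  have h3 := left_ne_zero_of_mul h1
  have h4 := right_ne_zero_of_mul h1
  have h5 := right_ne_zero_of_mul (left_ne_zero_of_mul h2)
  have h6 := right_ne_zero_of_mul (right_ne_zero_of_mul h2)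
  field_simp
  ring

/-- Put $\varphi_i(x)=\prod_{j<i}(x-j)(n+1-x-j)$, a polynomial of degree $i$ in $x(n+1-x)$. The
Racah difference operator with coefficients $a_x,c_x$ sends $\varphi_{i+1}$ to a combination of
$\varphi_{i+1}$ and $\varphi_i$ only. -/
theorem difference_fall {n m k x : ℕ} (hm : 2 * m ≤ n) (hx : x ≤ m) (i : ℕ) :
    recA n m k x * (fall (x + 1) (i + 1) * fall (n + 1 - (x + 1)) (i + 1) -
        fall x (i + 1) * fall (n + 1 - x) (i + 1)) +
      recC n m k x * (fall (x - 1) (i + 1) * fall (n + 1 - (x - 1)) (i + 1) -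
        fall x (i + 1) * fall (n + 1 - x) (i + 1)) =
      (i + 1) * ((i + 1 - (n - k)) * (fall x (i + 1) * fall (n + 1 - x) (i + 1)) +
        (m - i) * (n - m - i) * (n - k - i) * (fall x i * fall (n + 1 - x) i)) := by
  have hx' : (x : ℝ) ≤ m := by exact_mod_cast hx
  have hm' : 2 * (m : ℝ) ≤ n := by exact_mod_cast hm
  have hd1 : (n : ℝ) - 2 * x + 1 ≠ 0 := (by linarith : 0 < (n : ℝ) - 2 * x + 1).ne'
  have hd2 : (n : ℝ) - 2 * x + 2 ≠ 0 := (by linarith : 0 < (n : ℝ) - 2 * x + 2).ne'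
  have hP := fall_shift (x : ℝ) i
  have hQ := fall_shift ((n : ℝ) + 1 - x) i
  have e1 : (n : ℝ) + 1 - (x + 1) = n - x := by ring
  have e2 : (n : ℝ) + 1 - x - 1 = n - x := by ring
  have e3 : (n : ℝ) + 1 - (x - 1) = n + 2 - x := by ring
  have e4 : (n : ℝ) + 2 - x - 1 = n + 1 - x := by ring
  rw [e2] at hQ
  set P := fall (x : ℝ) i
  set Q := fall ((n : ℝ) + 1 - x) i
  set P' := fall ((x : ℝ) - 1) i
  set Q' := fall ((n : ℝ) - x) i
  have hA : recA n m k x * (fall (x + 1) (i + 1) * fall (n + 1 - (x + 1)) (i + 1) -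
      fall x (i + 1) * fall (n + 1 - x) (i + 1)) =
      (i + 1) * ((m - x) * (n - m - x) * (n - k - x) / (n - 2 * x + 1)) * P *
        (Q * (n + 1 - x - i)) := by
    rw [e1, fall_succ' ((x : ℝ) + 1), add_sub_cancel_right, fall_succ ((n : ℝ) - x),
      fall_succ (x : ℝ), fall_succ' ((n : ℝ) + 1 - x), e2, ← hQ]
    by_cases hxm : x = m
    · subst hxm
      simp [recA]
    · have h1 : (x : ℝ) + 1 ≤ m := by exact_mod_cast (by omega : x + 1 ≤ m)
      have hd0 : (n : ℝ) - 2 * x ≠ 0 := (by linarith : 0 < (n : ℝ) - 2 * x).ne'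
      have hu := inv_mul_cancel₀ hd0
      rw [recA, div_eq_mul_inv, mul_inv, div_eq_mul_inv]
      -- The bracket equals $(i+1)(n-2x)PQ'$, which cancels the factor $n-2x$ in the denominator of
      -- $a_x$. The term with $c_x$ works the same way with $n-2x+2$.
      change _ * ((x + 1) * P * (Q' * (n - x - i)) - P * (x - i) * ((n + 1 - x) * Q')) = _
      generalize ((n : ℝ) - 2 * x)⁻¹ = u₀ at *
      generalize ((n : ℝ) - 2 * x + 1)⁻¹ = u₁ at *
      linear_combination ((m - x) * (n - m - x) * (n - k - x) * (n - x + 1) * u₁ * P * Q' *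
        (i + 1)) * hu
  have hC : recC n m k x * (fall (x - 1) (i + 1) * fall (n + 1 - (x - 1)) (i + 1) -
      fall x (i + 1) * fall (n + 1 - x) (i + 1)) =
      -((i + 1) * ((x - k - 1) * (m - x + 1) * (n - m - x + 1) / (n - 2 * x + 1)) * Q *
        (P * (x - i))) := by
    rw [e3, fall_succ ((x : ℝ) - 1), fall_succ' ((n : ℝ) + 2 - x), e4, fall_succ' (x : ℝ),
      fall_succ ((n : ℝ) + 1 - x), ← hP, recC]
    rw [div_eq_mul_inv, mul_inv, div_eq_mul_inv]
    have hu := inv_mul_cancel₀ hd2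
    change _ * (P' * (x - 1 - i) * ((n + 2 - x) * Q) - x * P' * (Q * (n + 1 - x - i))) = _
    generalize ((n : ℝ) - 2 * x + 2)⁻¹ = u₂ at *
    generalize ((n : ℝ) - 2 * x + 1)⁻¹ = u₁ at *
    linear_combination (-(x * (x - k - 1) * (m - x + 1) * (n - m - x + 1) * u₁ * Q * P' *
      (i + 1))) * hu
  rw [hA, hC, fall_succ (x : ℝ), fall_succ ((n : ℝ) + 1 - x)]
  change _ = (i + 1) * ((i + 1 - (n - k)) * (P * (x - i) * (Q * (n + 1 - x - i))) +
    (m - i) * (n - m - i) * (n - k - i) * (P * Q))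
  rw [div_eq_mul_inv, div_eq_mul_inv]
  have hu := inv_mul_cancel₀ hd1
  generalize ((n : ℝ) - 2 * x + 1)⁻¹ = u₁ at *
  linear_combination ((i + 1) * P * Q * ((i + 1 - (n - k)) * ((x - i) * (n + 1 - x - i)) +
    (m - i) * (n - m - i) * (n - k - i))) * hu

/-- The number of pairs `(I, S')`, where `I` is an `i`-subset of a fixed `M`-subset of a `T`-set
and `S'` is an `M`-subset of the `T`-set disjoint from `I`. -/
def pairCount (T M i : ℕ) : ℕ := M.choose i * (T - i).choose M

theorem pairCount_succ {T M : ℕ} (hM : M ≤ T) (i : ℕ) :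
    (pairCount T M (i + 1) : ℝ) * ((i + 1) * (T - i)) =
      (M - i) * (T - M - i) * pairCount T M i := by
  unfold pairCount
  rcases lt_or_ge i M with hi | hi
  · have h1 : (M.choose (i + 1) : ℝ) * (i + 1) = M.choose i * (M - i) := by
      have h2 : ((M.choose (i + 1) * (i + 1) : ℕ) : ℝ) = (M.choose i * (M - i) : ℕ) := by
        rw [Nat.choose_succ_right_eq]
      rw [Nat.cast_mul, Nat.cast_mul, Nat.cast_sub hi.le] at h2
      push_cast at h2
      exact h2
    have h3 : ((T - (i + 1)).choose M : ℝ) * (T - i) = (T - i).choose M * (T - M - i) := by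
      obtain ⟨R, hR⟩ : ∃ R, T = R + 1 + i := ⟨T - i - 1, by omega⟩
      have e1 : T - (i + 1) = R := by omega
      have e2 : T - i = R + 1 := by omega
      have e3 : (T : ℝ) = R + 1 + i := by exact_mod_cast hR
      rw [e1, e2, e3]
      have h4 := Nat.choose_mul_succ_eq R M
      rcases le_or_gt M (R + 1) with h5 | h5
      · have h6 : ((R.choose M * (R + 1) : ℕ) : ℝ) = ((R + 1).choose M * (R + 1 - M) : ℕ) := by
          rw [h4]
        rw [Nat.cast_mul, Nat.cast_mul, Nat.cast_sub h5] at h6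
        push_cast at h6
        linear_combination h6
      · rw [Nat.choose_eq_zero_of_lt h5, Nat.choose_eq_zero_of_lt (by omega : R < M)]
        simp
    push_cast
    linear_combination ((T - (i + 1)).choose M : ℝ) * (T - i) * h1 +
      (M.choose i : ℝ) * (M - i) * h3
  · rw [Nat.choose_eq_zero_of_lt (by omega : M < i + 1)]
    rcases hi.eq_or_lt with rfl | hi
    · simp
    · rw [Nat.choose_eq_zero_of_lt hi]; simp

/-- The probability divided by the dimension, up to a factor independent of `x`. -/
noncomputable def racahSum (n m k l : ℕ) (x : ℝ) : ℝ :=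
  ∑ i ∈ Finset.range (m + 1), hahnCoeff n m x i * pairCount (n - k) (m - l) i

/-- With $M=m-l$ and $N=n-m-k+l$, the sum is a constant times
${}_4F_3(-x,\,x-n-1,\,-M,\,-N;\,-m,\,m-n,\,k-n;\,1)$. By `difference_fall` and the ratio of
consecutive pair counts, the contributions to each $\varphi_i$ cancel between neighbouring indices.
-/
theorem racahSum_difference {n m k l x : ℕ} (hm : 2 * m ≤ n) (hk : k ≤ n) (hl : m + k ≤ n + l)
    (hlm : l ≤ m) (hx : x ≤ m) :
    recA n m k x * racahSum n m k l (x + 1) -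
      (recA n m k x + recC n m k x - ((m : ℝ) - l) * (n - m - k + l)) * racahSum n m k l x +
      recC n m k x * racahSum n m k l (x - 1) = 0 := by
  set ρ : ℕ → ℝ := fun i =>
    (-1) ^ i * pairCount (n - k) (m - l) i / (fall m i * fall (n - m) i) with hρ
  set t : ℕ → ℝ := fun i => ρ i * ((m - l - i) * (n - m - k + l - i)) *
    (fall x i * fall (n + 1 - x) i) with ht
  have hq : ∀ y : ℝ, racahSum n m k l y =
      ∑ i ∈ Finset.range (m + 1), ρ i * (fall y i * fall (n + 1 - y) i) := fun y =>
    Finset.sum_congr rfl fun i _ => by simp only [hahnCoeff, hρ]; ring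
  -- Summed up to $j$, only the uncancelled multiple of $\varphi_j$ remains.
  have hstep : ∀ j ≤ m, ∑ i ∈ Finset.range (j + 1),
      (recA n m k x * (ρ i * (fall (x + 1) i * fall (n + 1 - (x + 1)) i)) -
      (recA n m k x + recC n m k x - ((m : ℝ) - l) * (n - m - k + l)) *
        (ρ i * (fall x i * fall (n + 1 - x) i)) +
      recC n m k x * (ρ i * (fall (x - 1) i * fall (n + 1 - (x - 1)) i))) = t j := by
    intro j
    induction j with
    | zero =>
      intro _
      simp only [zero_add, Finset.sum_range_one, fall_zero, ht]
      push_cast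
      ring
    | succ j ih =>
      intro hj
      rw [Finset.sum_range_succ, ih (by omega)]
      have h1 := difference_fall (k := k) hm hx j
      have h2 : ρ (j + 1) * ((j + 1) * ((m - j) * (n - m - j) * (n - k - j))) =
          -(ρ j * ((m - l - j) * (n - m - k + l - j))) := by
        have h3 := pairCount_succ (T := n - k) (M := m - l) (by omega) j
        rw [Nat.cast_sub hk, Nat.cast_sub hlm] at h3
        have h5 := fall_mul_fall_ne_zero hm (by omega : j ≤ m)
        have h6 := fall_mul_fall_ne_zero hm hj
        simp only [hρ, fall_succ] at h6 ⊢
        have h7 := left_ne_zero_of_mul h5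
        have h8 := right_ne_zero_of_mul h5
        have h9 := right_ne_zero_of_mul (left_ne_zero_of_mul h6)
        have h10 := right_ne_zero_of_mul (right_ne_zero_of_mul h6)
        field_simp
        rw [pow_succ]
        linear_combination (-(-1 : ℝ) ^ j) * h3
      simp only [ht]
      push_cast
      linear_combination ρ (j + 1) * h1 + (fall x j * fall (n + 1 - x) j) * h2
  have hlast : t m = 0 := by
    simp only [ht, hρ]
    rcases Nat.eq_zero_or_pos l with rfl | hl0
    · simp
    · rw [pairCount, Nat.choose_eq_zero_of_lt (by omega : m - l < m)]
      simp
  have := hstep m le_rfl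
  rw [hlast, Finset.sum_add_distrib, Finset.sum_sub_distrib, ← Finset.mul_sum, ← Finset.mul_sum,
    ← Finset.mul_sum, ← hq, ← hq, ← hq] at this
  exact this

/-- Double counting: the binomial counts the $i$-subsets $I$ of $S$ disjoint from $S'$, and for
fixed $I$ the set $S'$ ranges over the $M$-subsets of $U\setminus I$. -/
theorem sum_choose_card_sdiff {α : Type*} [DecidableEq α] {U S : Finset α} {M : ℕ} (hS : S ⊆ U)
    (hM : S.card = M) (i : ℕ) :
    ∑ S' ∈ U.powersetCard M, (S \ S').card.choose i = pairCount U.card M i := by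
  have h1 : ∀ S', (S \ S').card.choose i =
      ∑ I ∈ S.powersetCard i, if Disjoint I S' then 1 else 0 := by
    intro S'
    rw [← Finset.card_powersetCard, ← Finset.card_filter]
    congr 1
    ext I
    simp only [Finset.mem_powersetCard, Finset.mem_filter, Finset.subset_sdiff]
    tauto
  simp only [h1]
  rw [Finset.sum_comm]
  have h2 : ∀ I ∈ S.powersetCard i,
      (∑ S' ∈ U.powersetCard M, if Disjoint I S' then 1 else 0) = (U.card - i).choose M := by
    intro I hI
    rw [Finset.mem_powersetCard] at hI
    rw [← Finset.card_filter, ← hI.2, ← Finset.card_sdiff_of_subset (hI.1.trans hS),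
      ← Finset.card_powersetCard]
    congr 1
    ext S'
    simp only [Finset.mem_powersetCard, Finset.mem_filter, Finset.subset_sdiff,
      disjoint_comm (a := I)]
    tauto
  rw [Finset.sum_congr rfl h2, Finset.sum_const, Finset.card_powersetCard, hM]
  rfl

end AsymState

/-! ### The Johnson graph: spectral decomposition in fixed weight -/

namespace AsymState

open Equiv

variable {n : ℕ}

/-- The number of positions where `w` has the letter `1` and `w'` the letter `0`. -/
def excess (w w' : Fin n → Fin 2) : ℕ :=
  (Finset.univ.filter fun a => w a = 1 ∧ w' a = 0).card

/-- The indicator of the positions where `w` has the letter `s` and `w'` the letter `t`. -/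
def pairInd (w w' : Fin n → Fin 2) (s t : Fin 2) (a : Fin n) : ℤ :=
  if w a = s ∧ w' a = t then 1 else 0

theorem sum_pairInd_one_zero (w w' : Fin n → Fin 2) :
    ∑ a, pairInd w w' 1 0 a = excess w w' := by
  simp only [pairInd, excess, Finset.sum_boole]

theorem cast_weight (w : Fin n → Fin 2) : (weight w : ℤ) = ∑ a, ((w a : ℕ) : ℤ) := by
  rw [weight_eq_sum]; push_cast; rfl

theorem sum_pairInd_one_one (w w' : Fin n → Fin 2) :
    ∑ a, pairInd w w' 1 1 a = weight w - excess w w' := by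
  rw [← sum_pairInd_one_zero, cast_weight, ← Finset.sum_sub_distrib]
  refine Finset.sum_congr rfl fun a _ => ?_
  unfold pairInd
  generalize w a = s
  generalize w' a = t
  revert s t; decide

theorem sum_pairInd_zero_one (w w' : Fin n → Fin 2) :
    ∑ a, pairInd w w' 0 1 a = weight w' - (weight w - excess w w') := by
  rw [← sum_pairInd_one_one, cast_weight, ← Finset.sum_sub_distrib]
  refine Finset.sum_congr rfl fun a _ => ?_
  unfold pairInd
  generalize w a = s
  generalize w' a = t
  revert s t; decide

theorem sum_pairInd_zero_zero (w w' : Fin n → Fin 2) :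
    ∑ a, pairInd w w' 0 0 a = n - weight w' - excess w w' := by
  have h : (n : ℤ) = ∑ a : Fin n, 1 := by simp
  rw [← sum_pairInd_one_zero, cast_weight, h, ← Finset.sum_sub_distrib, ← Finset.sum_sub_distrib]
  refine Finset.sum_congr rfl fun a _ => ?_
  unfold pairInd
  generalize w a = s
  generalize w' a = t
  revert s t; decide

theorem excess_eq_sum (w w' : Fin n → Fin 2) :
    (excess w w' : ℤ) = ∑ a, ((w a : ℕ) : ℤ) * (1 - ((w' a : ℕ) : ℤ)) := by
  rw [← sum_pairInd_one_zero]
  refine Finset.sum_congr rfl fun a _ => ?_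
  unfold pairInd
  generalize w a = s
  generalize w' a = t
  revert s t; decide

theorem excess_comp_swap (w w' : Fin n → Fin 2) (a b : Fin n) :
    (excess (w ∘ swap a b) w' : ℤ) = excess w w' +
      (((w b : ℕ) : ℤ) - (w a : ℕ)) * (((w' b : ℕ) : ℤ) - (w' a : ℕ)) := by
  rw [excess_eq_sum, excess_eq_sum]
  have h1 : ∀ c, (((w ∘ swap a b) c : ℕ) : ℤ) = (w c : ℕ) +
      ((if c = a then ((w b : ℕ) : ℤ) - (w a : ℕ) else 0) +
        (if c = b then ((w a : ℕ) : ℤ) - (w b : ℕ) else 0)) := by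
    intro c
    rw [Function.comp, swap_apply_def]
    by_cases h1 : c = a
    · by_cases h2 : c = b
      · subst h1; subst h2; simp
      · subst h1; simp [h2]
    · by_cases h2 : c = b
      · subst h2; simp [h1]
      · simp [h1, h2]
  simp only [h1, add_mul, Finset.sum_add_distrib, ite_mul, zero_mul, Finset.sum_ite_eq',
    Finset.mem_univ, if_true]
  ring

theorem excess_pos_of {w w' : Fin n → Fin 2} {a : Fin n} (h : w a = 1 ∧ w' a = 0) :
    0 < excess w w' :=
  Finset.card_pos.2 ⟨a, by simpa using h⟩

/-- A swap changes the distance by at most one, depending only on the letter pairs at the two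
positions. The truncated `excess w w' - 1` is harmless: its coefficient needs a position with
letters $(1,0)$, and then the excess is positive. -/
theorem apply_excess_comp_swap (G : ℕ → ℤ) (w w' : Fin n → Fin 2) (a b : Fin n) :
    G (excess (w ∘ swap a b) w') = G (excess w w') +
      (pairInd w w' 1 1 a * pairInd w w' 0 0 b + pairInd w w' 0 0 a * pairInd w w' 1 1 b) *
        (G (excess w w' + 1) - G (excess w w')) +
      (pairInd w w' 1 0 a * pairInd w w' 0 1 b + pairInd w w' 0 1 a * pairInd w w' 1 0 b) *
        (G (excess w w' - 1) - G (excess w w')) := by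
  have h := excess_comp_swap w w' a b
  have hpa := excess_pos_of (w := w) (w' := w') (a := a)
  have hpb := excess_pos_of (w := w) (w' := w') (a := b)
  unfold pairInd
  generalize excess (w ∘ swap a b) w' = e' at *
  generalize excess w w' = e at *
  generalize w a = s₁ at *
  generalize w b = s₂ at *
  generalize w' a = t₁ at *
  generalize w' b = t₂ at *
  fin_cases s₁ <;> fin_cases s₂ <;> fin_cases t₁ <;> fin_cases t₂ <;>
    simp at h hpa hpb ⊢ <;>
    first
      | rw [show e' = e by omega]
      | rw [show e' = e + 1 by omega]
      | rw [show e' = e - 1 by omega]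

theorem sum_apply_excess_comp_swap (G : ℕ → ℤ) {m : ℕ} {w w' : Fin n → Fin 2}
    (hw : weight w = m) (hw' : weight w' = m) :
    ∑ a, ∑ b, G (excess (w ∘ swap a b) w') = n ^ 2 * G (excess w w') +
      2 * ((m - excess w w') * (n - m - excess w w')) *
        (G (excess w w' + 1) - G (excess w w')) +
      2 * (excess w w' : ℤ) ^ 2 * (G (excess w w' - 1) - G (excess w w')) := by
  simp only [apply_excess_comp_swap, Finset.sum_add_distrib, ← Finset.sum_mul,
    ← Finset.sum_mul_sum, sum_pairInd_one_zero, sum_pairInd_one_one, sum_pairInd_zero_one,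
    sum_pairInd_zero_zero, hw, hw', Finset.sum_const, Finset.card_univ, Fintype.card_fin,
    nsmul_eq_mul]
  ring

theorem sum_choose_zero_excess {m : ℕ} {w w' : Fin n → Fin 2}
    (hw : weight w = m) (hw' : weight w' = m) :
    ∑ a, ∑ b, ((excess (w ∘ swap a b) w').choose 0 : ℤ) =
      n ^ 2 * (excess w w').choose 0 := by
  rw [sum_apply_excess_comp_swap (fun f => (f.choose 0 : ℤ)) hw hw']
  simp

/-- The functions $\binom ei$ make the Johnson operator bidiagonal; the diagonal entry is the
eigenvalue `swapEig` at $i+1$. -/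
theorem sum_choose_succ_excess {m : ℕ} {w w' : Fin n → Fin 2}
    (hw : weight w = m) (hw' : weight w' = m) (i : ℕ) :
    ∑ a, ∑ b, ((excess (w ∘ swap a b) w').choose (i + 1) : ℤ) =
      (n ^ 2 - 2 * ((i + 1) * (n - i))) * (excess w w').choose (i + 1) +
        2 * ((m - i) * (n - m - i)) * (excess w w').choose i := by
  rw [sum_apply_excess_comp_swap (fun f => (f.choose (i + 1) : ℤ)) hw hw']
  generalize excess w w' = f
  have h1 : ((f + 1).choose (i + 1) : ℤ) = f.choose i + f.choose (i + 1) := by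
    rw [Nat.choose_succ_succ]; push_cast; rfl
  have h2 : (f.choose (i + 1) : ℤ) * (i + 1) = f.choose i * (f - i) := by
    rcases le_or_gt i f with h | h
    · have h3 : ((f.choose (i + 1) * (i + 1) : ℕ) : ℤ) = (f.choose i * (f - i) : ℕ) := by
        rw [Nat.choose_succ_right_eq]
      rw [Nat.cast_mul, Nat.cast_mul, Nat.cast_sub h] at h3
      push_cast at h3
      exact h3
    · rw [Nat.choose_eq_zero_of_lt h, Nat.choose_eq_zero_of_lt (by omega : f < i + 1)]
      simp
  have h3 : (f : ℤ) * (((f - 1).choose (i + 1) : ℤ) - f.choose (i + 1)) =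
      -((i + 1) * f.choose (i + 1)) := by
    cases f with
    | zero => simp
    | succ f =>
      rw [Nat.add_sub_cancel]
      have h4 : ((f + 1).choose (i + 1) : ℤ) = f.choose i + f.choose (i + 1) := by
        rw [Nat.choose_succ_succ]; push_cast; rfl
      have h5 : (((f + 1) * f.choose i : ℕ) : ℤ) = ((f + 1).choose (i + 1) * (i + 1) : ℕ) := by
        rw [Nat.add_one_mul_choose_eq]
      push_cast at h5 ⊢
      linear_combination (-(f : ℤ) - 1) * h4 - h5
  simp only [h1]
  linear_combination (2 * (f : ℤ)) * h3 + (2 * ((n : ℤ) - i - f)) * h2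

theorem act_swapSum_apply (v : Qubits n) (w : Fin n → Fin 2) :
    act (swapSum n) v w = ∑ a, ∑ b, v (w ∘ swap a b) := by
  simp only [swapSum, act_sum, WithLp.ofLp_sum, Finset.sum_apply, act_grp, permRep_apply]

/-- The vector with amplitude `∑ v(w') C(|w ∖ w'|, i)` at the words `w` of weight `m`. -/
noncomputable def distVec (m i : ℕ) (v : Qubits n) : Qubits n :=
  WithLp.toLp 2 fun w => if weight w = m then ∑ w', v w' * ((excess w w').choose i : ℂ) else 0

theorem distVec_apply (m i : ℕ) (v : Qubits n) (w : Fin n → Fin 2) : distVec m i v w =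
    if weight w = m then ∑ w', v w' * ((excess w w').choose i : ℂ) else 0 := rfl

theorem act_swapSum_distVec_apply {m : ℕ} {v : Qubits n} (i : ℕ) {w : Fin n → Fin 2}
    (hw : weight w = m) :
    act (swapSum n) (distVec m i v) w =
      ∑ w', v w' * ((∑ a, ∑ b, ((excess (w ∘ swap a b) w').choose i : ℤ) : ℤ) : ℂ) := by
  rw [act_swapSum_apply]
  simp only [distVec_apply, weight_comp, hw, if_true]
  push_cast
  simp only [Finset.mul_sum]
  rw [Finset.sum_congr rfl fun a _ => Finset.sum_comm, Finset.sum_comm]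

theorem act_swapSum_distVec_of_ne {m : ℕ} {v : Qubits n} (i : ℕ) {w : Fin n → Fin 2}
    (hw : weight w ≠ m) : act (swapSum n) (distVec m i v) w = 0 := by
  rw [act_swapSum_apply]
  simp only [distVec_apply, weight_comp, hw, if_false, Finset.sum_const_zero]

theorem act_swapSum_distVec_zero {m : ℕ} {v : Qubits n} (hv : ∀ w, v w ≠ 0 → weight w = m) :
    act (swapSum n) (distVec m 0 v) = (n : ℂ) ^ 2 • distVec m 0 v := by
  ext w
  by_cases hw : weight w = m
  · rw [act_swapSum_distVec_apply 0 hw, PiLp.smul_apply, distVec_apply, if_pos hw, smul_eq_mul,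
      Finset.mul_sum]
    refine Finset.sum_congr rfl fun w' _ => ?_
    by_cases h0 : v w' = 0
    · simp [h0]
    · rw [sum_choose_zero_excess hw (hv w' h0)]
      push_cast
      ring
  · rw [act_swapSum_distVec_of_ne 0 hw, PiLp.smul_apply, distVec_apply, if_neg hw, smul_zero]

theorem act_swapSum_distVec_succ {m : ℕ} {v : Qubits n} (hv : ∀ w, v w ≠ 0 → weight w = m)
    (i : ℕ) : act (swapSum n) (distVec m (i + 1) v) =
      ((n : ℂ) ^ 2 - 2 * ((i + 1) * (n - i))) • distVec m (i + 1) v +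
        (2 * (((m : ℂ) - i) * (n - m - i))) • distVec m i v := by
  ext w
  rw [PiLp.add_apply, PiLp.smul_apply, PiLp.smul_apply, distVec_apply, distVec_apply]
  by_cases hw : weight w = m
  · rw [act_swapSum_distVec_apply (i + 1) hw, if_pos hw, if_pos hw, smul_eq_mul, smul_eq_mul,
      Finset.mul_sum, Finset.mul_sum, ← Finset.sum_add_distrib]
    refine Finset.sum_congr rfl fun w' _ => ?_
    by_cases h0 : v w' = 0
    · simp [h0]
    · rw [sum_choose_succ_excess hw (hv w' h0)]
      push_cast
      ring
  · rw [act_swapSum_distVec_of_ne (i + 1) hw, if_neg hw, if_neg hw]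
    simp

/-- Up to a positive factor, the component of `v` in the isotypical component of shape
`(n-x, x)`. -/
noncomputable def hahnVec (m x : ℕ) (v : Qubits n) : Qubits n :=
  ∑ i ∈ Finset.range (m + 1), (hahnCoeff n m x i : ℂ) • distVec m i v

/-- The ratio of consecutive Hahn coefficients in `hahnCoeff_succ` is what the bidiagonal action
requires for an eigenvector, so the defect telescopes to a multiple of the last distance vector. -/
theorem hahnVec_mem_swapSpace {m x : ℕ} (hm : 2 * m ≤ n) (hx : x ≤ m) {v : Qubits n}
    (hv : ∀ w, v w ≠ 0 → weight w = m) : hahnVec m x v ∈ swapSpace n x := by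
  rw [mem_swapSpace, ← sub_eq_zero, hahnVec, map_sum, Finset.smul_sum, ← Finset.sum_sub_distrib]
  have hpart : ∀ j ≤ m, ∑ i ∈ Finset.range (j + 1),
      (act (swapSum n) ((hahnCoeff n m x i : ℂ) • distVec m i v) -
        swapEig n x • (hahnCoeff n m x i : ℂ) • distVec m i v) =
      (2 * ((hahnCoeff n m x j : ℂ) * ((x - j) * (n + 1 - x - j)))) • distVec m j v := by
    intro j
    induction j with
    | zero =>
      intro _
      rw [zero_add, Finset.sum_range_one, map_smul, act_swapSum_distVec_zero hv, smul_smul,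
        smul_smul, ← sub_smul]
      congr 1
      rw [swapEig]
      push_cast
      ring
    | succ j ih =>
      intro hj
      have h1 : (hahnCoeff n m x (j + 1) : ℂ) * ((m - j) * (n - m - j)) =
          -(hahnCoeff n m x j * ((x - j) * (n + 1 - x - j))) := by
        exact_mod_cast congrArg (fun r : ℝ => (r : ℂ)) (hahnCoeff_succ hm hj x)
      rw [Finset.sum_range_succ, ih (by omega), map_smul, act_swapSum_distVec_succ hv, smul_add,
        smul_smul, smul_smul, smul_smul]
      have h2 : (hahnCoeff n m x (j + 1) : ℂ) * (2 * (((m : ℂ) - j) * (n - m - j))) =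
          -(2 * ((hahnCoeff n m x j : ℂ) * ((x - j) * (n + 1 - x - j)))) := by
        linear_combination 2 * h1
      have h3 : (hahnCoeff n m x (j + 1) : ℂ) * ((n : ℂ) ^ 2 - 2 * ((j + 1) * (n - j))) -
          swapEig n x * (hahnCoeff n m x (j + 1) : ℂ) =
          2 * ((hahnCoeff n m x (j + 1) : ℂ) *
            ((x - ((j + 1 : ℕ) : ℂ)) * (n + 1 - x - ((j + 1 : ℕ) : ℂ)))) := by
        rw [swapEig]; push_cast; ring
      rw [h2, ← h3, neg_smul, sub_smul]
      abel
  rw [hpart m le_rfl]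
  -- The remaining defect vanishes through $x-m$ if $x=m$, and through the falling factorial in the
  -- coefficient if $x<m$.
  have h0 : (hahnCoeff n m x m : ℂ) * ((x - m) * (n + 1 - x - m)) = 0 := by
    rcases hx.eq_or_lt with rfl | hx
    · simp
    · rw [hahnCoeff, fall_eq_zero hx]; simp
  rw [h0]
  simp

theorem excess_le (w w' : Fin n → Fin 2) : excess w w' ≤ weight w :=
  Finset.card_le_card fun a ha => by
    simp only [Finset.mem_filter, Finset.mem_univ, true_and] at ha ⊢
    exact ha.1

theorem excess_eq_zero_iff {w w' : Fin n → Fin 2} (h : weight w = weight w') :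
    excess w w' = 0 ↔ w' = w := by
  constructor
  · intro h0
    rw [excess, Finset.card_eq_zero, Finset.filter_eq_empty_iff] at h0
    have hsub : (Finset.univ.filter fun i => w i = 1) ⊆ Finset.univ.filter fun i => w' i = 1 := by
      intro i hi
      simp only [Finset.mem_filter, Finset.mem_univ, true_and] at hi ⊢
      exact fin_two_ne_zero.1 fun e => h0 (Finset.mem_univ i) ⟨hi, e⟩
    have heq := Finset.eq_of_subset_of_card_le hsub h.ge
    ext i
    have h2 : ∀ a b : Fin 2, (b = 1 ↔ a = 1) → (a : ℕ) = b := by decide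
    refine h2 _ _ ?_
    simpa using Finset.ext_iff.1 heq i
  · rintro rfl
    rw [excess, Finset.card_eq_zero, Finset.filter_eq_empty_iff]
    rintro a - ⟨h1, h2⟩
    rw [h1] at h2
    exact absurd h2 (by decide)

theorem sum_alternating_choose {m f : ℕ} (hf : f ≤ m) :
    ∑ i ∈ Finset.range (m + 1), (-1 : ℝ) ^ i * (f.choose i : ℝ) = if f = 0 then 1 else 0 := by
  have h1 : ∑ i ∈ Finset.range (m + 1), (-1 : ℝ) ^ i * (f.choose i : ℝ) =
      ∑ i ∈ Finset.range (f + 1), (-1 : ℝ) ^ i * (f.choose i : ℝ) := by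
    refine (Finset.sum_subset (Finset.range_mono (by omega)) fun i _ hi => ?_).symm
    rw [Finset.mem_range, not_lt] at hi
    rw [Nat.choose_eq_zero_of_lt (by omega)]
    simp
  rw [h1]
  exact_mod_cast congrArg (fun z : ℤ => (z : ℝ)) (Int.alternating_sum_range_choose (n := f))

theorem sum_spechtDim_mul_hahnCoeff {m i : ℕ} (hm : 2 * m ≤ n) (hi : i ≤ m) :
    ∑ x ∈ Finset.range (m + 1), spechtDim n x * hahnCoeff n m x i =
      n.choose m * (-1) ^ i := by
  have h1 := sum_spechtDim_mul_fall (n := n) (m := m) (by omega) i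
  have h2 := fall_mul_fall_ne_zero hm hi
  have h3 : ∀ x ∈ Finset.range (m + 1), spechtDim n x * hahnCoeff n m x i =
      spechtDim n x * (fall x i * fall (n + 1 - x) i) *
        ((-1) ^ i / (fall m i * fall (n - m) i)) := fun x _ => by
    rw [hahnCoeff]; ring
  rw [Finset.sum_congr rfl h3, ← Finset.sum_mul, h1, mul_assoc, mul_div_cancel₀ _ h2]

/-- Resolution of the identity: the dimension-weighted sum over $x$ leaves $\binom
nm\sum_i(-1)^i\binom ei$, which is $\binom nm$ at distance $e=0$ and zero elsewhere. -/
theorem sum_spechtDim_smul_hahnVec {m : ℕ} (hm : 2 * m ≤ n) {v : Qubits n}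
    (hv : ∀ w, v w ≠ 0 → weight w = m) :
    ∑ x ∈ Finset.range (m + 1), (spechtDim n x : ℂ) • hahnVec m x v =
      (n.choose m : ℂ) • v := by
  have h1 : ∑ x ∈ Finset.range (m + 1), (spechtDim n x : ℂ) • hahnVec m x v =
      ∑ i ∈ Finset.range (m + 1), ((n.choose m * (-1) ^ i : ℝ) : ℂ) • distVec m i v := by
    simp only [hahnVec, Finset.smul_sum, smul_smul]
    rw [Finset.sum_comm]
    refine Finset.sum_congr rfl fun i hi => ?_
    rw [← Finset.sum_smul,
      ← sum_spechtDim_mul_hahnCoeff hm (Nat.lt_succ_iff.1 (Finset.mem_range.1 hi))]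
    push_cast
    rfl
  rw [h1]
  ext w
  rw [WithLp.ofLp_sum, Finset.sum_apply, PiLp.smul_apply]
  simp only [PiLp.smul_apply, distVec_apply, smul_eq_mul]
  by_cases hw : weight w = m
  · simp only [hw, if_true, Finset.mul_sum]
    rw [Finset.sum_comm, Finset.sum_eq_single w]
    · have h2 := sum_alternating_choose (m := m) (f := excess w w) (hw ▸ excess_le w w)
      rw [if_pos ((excess_eq_zero_iff rfl).2 rfl)] at h2
      have h3 : ∑ i ∈ Finset.range (m + 1), (-1 : ℂ) ^ i * ((excess w w).choose i : ℂ) = 1 := by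
        exact_mod_cast congrArg (fun r : ℝ => (r : ℂ)) h2
      rw [← mul_one (v w), ← h3, Finset.mul_sum, Finset.mul_sum]
      refine Finset.sum_congr rfl fun i _ => ?_
      push_cast
      rw [← Finset.mul_sum, h3]
      ring
    · intro w' _ hne
      by_cases h0 : v w' = 0
      · simp [h0]
      have h2 := sum_alternating_choose (m := m) (f := excess w w') (hw ▸ excess_le w w')
      rw [if_neg fun h => hne ((excess_eq_zero_iff (hw.trans (hv w' h0).symm)).1 h)] at h2
      have h3 : ∑ i ∈ Finset.range (m + 1), (-1 : ℂ) ^ i * ((excess w w').choose i : ℂ) = 0 := by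
        exact_mod_cast congrArg (fun r : ℝ => (r : ℂ)) h2
      rw [← mul_zero ((n.choose m : ℂ) * v w'), ← h3, Finset.mul_sum]
      refine Finset.sum_congr rfl fun i _ => ?_
      push_cast
      ring
    · simp
  · have h0 : v w = 0 := by
      by_contra h0
      exact hw (hv w h0)
    simp [hw, h0]

/-- In the resolution of the identity the summands lie in mutually orthogonal components, so the
projector picks out the one with index $x$. -/
theorem projector_eq_hahnVec {m x : ℕ} (hm : 2 * m ≤ n) (hx : x ≤ m) {v : Qubits n}
    (hv : ∀ w, v w ≠ 0 → weight w = m) :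
    projector n x v = ((spechtDim n x / n.choose m : ℝ) : ℂ) • hahnVec m x v := by
  have hC : (n.choose m : ℂ) ≠ 0 :=
    Nat.cast_ne_zero.2 (Nat.choose_pos (by omega)).ne'
  have hmem : ∀ y ∈ Finset.range (m + 1), hahnVec m y v ∈ isotypical n y := fun y hy => by
    have hy' := Finset.mem_range.1 hy
    rw [isotypical_eq_swapSpace (by omega)]
    exact hahnVec_mem_swapSpace hm (by omega) hv
  have hself : projector n x (hahnVec m x v) = hahnVec m x v :=
    Submodule.starProjection_eq_self_iff.2 (hmem x (Finset.mem_range.2 (by omega)))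
  have hother : ∀ y ∈ Finset.range (m + 1), y ≠ x → projector n x (hahnVec m y v) = 0 := by
    intro y hy hne
    have hy' := Finset.mem_range.1 hy
    refine (Submodule.starProjection_apply_eq_zero_iff _).2 ?_
    rw [Submodule.mem_orthogonal]
    intro u hu
    refine inner_eq_zero_of_mem_swapSpace (x := x) (y := y) (by omega) (by omega) hne.symm
      ((isotypical_eq_swapSpace (by omega)).le hu)
      ((isotypical_eq_swapSpace (by omega)).le (hmem y hy))
  have h1 := congrArg (projector n x) (sum_spechtDim_smul_hahnVec hm hv)
  rw [map_sum, Finset.sum_eq_single x, map_smul, map_smul, hself] at h1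
  · push_cast
    rw [div_eq_inv_mul, mul_smul, h1, smul_smul, inv_mul_cancel₀ hC, one_smul]
  · intro y hy hne
    rw [map_smul, hother y hy hne, smul_zero]
  · intro h
    exact absurd (Finset.mem_range.2 (by omega)) h

end AsymState

/-! ### Evaluation on $\Xi$ and the recurrence -/

namespace AsymState

open Equiv

variable {n : ℕ}

/-- The positions, other than the first `k`, where `w` has the letter `1`. -/
def tailOnes (k : ℕ) (w : Fin n → Fin 2) : Finset (Fin n) :=
  Finset.univ.filter fun a => k ≤ (a : ℕ) ∧ w a = 1

theorem mem_tailOnes {k : ℕ} {w : Fin n → Fin 2} {a : Fin n} :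
    a ∈ tailOnes k w ↔ k ≤ (a : ℕ) ∧ w a = 1 := by
  simp [tailOnes]

/-- The word beginning with `1^l 0^{k-l}` whose further letters `1` are at the positions `S`. -/
def xiWord (k l : ℕ) (S : Finset (Fin n)) : Fin n → Fin 2 :=
  fun a => if (a : ℕ) < k then (if (a : ℕ) < l then 1 else 0) else if a ∈ S then 1 else 0

/-- The positions other than the first `k`. -/
def tailPositions (n k : ℕ) : Finset (Fin n) := Finset.univ.filter fun a => k ≤ (a : ℕ)

theorem card_tailPositions {k : ℕ} (hk : k ≤ n) : (tailPositions n k).card = n - k := by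
  have h1 := Finset.card_filter_add_card_filter_not (s := (Finset.univ : Finset (Fin n)))
    (fun a => (a : ℕ) < k)
  simp only [not_lt, Fin.card_filter_val_lt, Finset.card_univ, Fintype.card_fin] at h1
  unfold tailPositions
  omega

theorem weight_eq_of_prefix {k l : ℕ} (hk : k ≤ n) (hlk : l ≤ k) {w : Fin n → Fin 2}
    (hw : ∀ i : Fin n, (i : ℕ) < k → w i = if (i : ℕ) < l then 1 else 0) :
    weight w = l + (tailOnes k w).card := by
  have h1 : (Finset.univ.filter fun i => w i = 1) =
      (Finset.univ.filter fun i : Fin n => (i : ℕ) < l) ∪ tailOnes k w := by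
    ext i
    simp only [tailOnes, Finset.mem_union, Finset.mem_filter, Finset.mem_univ, true_and]
    by_cases hi : (i : ℕ) < k
    · rw [hw i hi]
      by_cases hil : (i : ℕ) < l
      · simp [hil]
      · simp [hil]
    · have : ¬ (i : ℕ) < l := by omega
      simp [this, not_lt.1 hi]
  rw [weight, h1, Finset.card_union_of_disjoint, Fin.card_filter_val_lt, min_eq_right (by omega)]
  rw [Finset.disjoint_left]
  intro i hi hi'
  simp only [tailOnes, Finset.mem_filter, Finset.mem_univ, true_and] at hi hi'
  omega

theorem tailOnes_xiWord {k l : ℕ} {S : Finset (Fin n)} (hS : S ⊆ tailPositions n k) :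
    tailOnes k (xiWord k l S) = S := by
  ext a
  rw [mem_tailOnes, xiWord]
  constructor
  · rintro ⟨h1, h2⟩
    rw [if_neg (not_lt.2 h1)] at h2
    by_contra h3
    rw [if_neg h3] at h2
    exact absurd h2 (by decide)
  · intro ha
    have h1 : k ≤ (a : ℕ) := by
      have := hS ha
      unfold tailPositions at this
      simpa using this
    exact ⟨h1, by rw [if_neg (not_lt.2 h1), if_pos ha]⟩

/-- With the first $k$ letters prescribed, a word of $\Xi$ is determined by its ones in the tail, an
arbitrary $(m-l)$-subset. -/
theorem sum_isXiWord {m k l : ℕ} (hk : k ≤ n) (hlm : l ≤ m) (hlk : l ≤ k)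
    (F : Finset (Fin n) → ℕ) :
    ∑ w with IsXiWord (n := n) m k l w, F (tailOnes k w) =
      ∑ S ∈ (tailPositions n k).powersetCard (m - l), F S := by
  refine Finset.sum_bij' (fun w _ => tailOnes k w) (fun S _ => xiWord k l S) ?_ ?_ ?_ ?_ ?_
  · intro w hw
    have hw' : IsXiWord m k l w := by simpa using hw
    have h1 := weight_eq_of_prefix hk hlk hw'.1
    rw [Finset.mem_powersetCard]
    refine ⟨fun a ha => ?_, ?_⟩
    · simp only [tailOnes, tailPositions, Finset.mem_filter, Finset.mem_univ, true_and] at ha ⊢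
      exact ha.1
    · rw [hw'.2] at h1
      omega
  · intro S hS
    rw [Finset.mem_powersetCard] at hS
    have hpre : ∀ i : Fin n, (i : ℕ) < k →
        xiWord k l S i = if (i : ℕ) < l then 1 else 0 := fun i hi => if_pos hi
    simp only [Finset.mem_filter, Finset.mem_univ, true_and]
    refine ⟨hpre, ?_⟩
    rw [weight_eq_of_prefix hk hlk hpre, tailOnes_xiWord hS.1, hS.2]
    omega
  · intro w hw
    have hw' : IsXiWord m k l w := by simpa using hw
    ext a
    congr 1
    unfold xiWord
    by_cases ha : (a : ℕ) < k
    · rw [if_pos ha, hw'.1 a ha]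
    · rw [if_neg ha]
      by_cases h1 : w a = 1
      · simp [tailOnes, h1, not_lt.1 ha]
      · rw [if_neg (by simp [tailOnes, h1]), fin_two_ne_one.1 h1]
  · intro S hS
    rw [Finset.mem_powersetCard] at hS
    exact tailOnes_xiWord hS.1
  · intro w _
    rfl

theorem excess_eq_card_sdiff {m k l : ℕ} {w w' : Fin n → Fin 2} (hw : IsXiWord m k l w)
    (hw' : IsXiWord m k l w') : excess w w' = (tailOnes k w \ tailOnes k w').card := by
  unfold excess
  congr 1
  ext a
  simp only [tailOnes, Finset.mem_sdiff, Finset.mem_filter, Finset.mem_univ, true_and]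
  by_cases ha : (a : ℕ) < k
  · rw [hw.1 a ha, hw'.1 a ha]
    have : ¬ k ≤ (a : ℕ) := by omega
    split_ifs <;> simp [this]
  · simp only [not_lt.1 ha, true_and, ← ne_eq, fin_two_ne_one]

theorem sum_choose_excess {m k l : ℕ} (hk : k ≤ n) (hlm : l ≤ m) (hlk : l ≤ k)
    {w : Fin n → Fin 2} (hw : IsXiWord m k l w) (i : ℕ) :
    ∑ w' with IsXiWord (n := n) m k l w', (excess w w').choose i =
      pairCount (n - k) (m - l) i := by
  have h1 : ∀ w' ∈ Finset.univ.filter (IsXiWord (n := n) m k l), (excess w w').choose i =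
      (tailOnes k w \ tailOnes k w').card.choose i := fun w' hw' => by
    rw [excess_eq_card_sdiff hw (by simpa using hw')]
  have h2 := weight_eq_of_prefix hk hlk hw.1
  rw [hw.2] at h2
  rw [Finset.sum_congr rfl h1,
    sum_isXiWord hk hlm hlk fun S => (tailOnes k w \ S).card.choose i, ← card_tailPositions hk]
  refine sum_choose_card_sdiff (fun a ha => ?_) (by omega) i
  simp only [tailOnes, tailPositions, Finset.mem_filter, Finset.mem_univ, true_and] at ha ⊢
  exact ha.1

theorem card_isXiWord {m k l : ℕ} (hk : k ≤ n) (hlm : l ≤ m) (hlk : l ≤ k) :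
    (Finset.univ.filter (IsXiWord (n := n) m k l)).card = (n - k).choose (m - l) := by
  rw [Finset.card_eq_sum_ones, sum_isXiWord hk hlm hlk fun _ => 1, ← Finset.card_eq_sum_ones,
    Finset.card_powersetCard, card_tailPositions hk]

/-- The count $\sum_{w'}\binom ei$ is the same for every word $w$ of $\Xi$, and the normalization
cancels the number of words. -/
theorem inner_stateXi_distVec {m k l : ℕ} (hk : k ≤ n) (hl : m + k ≤ n + l) (hlm : l ≤ m)
    (hlk : l ≤ k) (i : ℕ) :
    inner ℂ (stateXi n m k l hk) (distVec m i (stateXi n m k l hk)) =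
      (pairCount (n - k) (m - l) i : ℂ) := by
  set s : ℂ := ((Real.sqrt ((n - k).choose (m - l) : ℝ) : ℂ))⁻¹ with hs
  have hC : (0 : ℝ) < (n - k).choose (m - l) := Nat.cast_pos.2 (Nat.choose_pos (by omega))
  have hss : s * s * ((n - k).choose (m - l) : ℂ) = 1 := by
    have h1 : (Real.sqrt ((n - k).choose (m - l) : ℝ) : ℂ) *
        (Real.sqrt ((n - k).choose (m - l) : ℝ) : ℂ) = ((n - k).choose (m - l) : ℂ) := by
      rw [← Complex.ofReal_mul, Real.mul_self_sqrt hC.le]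
      simp
    have h2 : ((n - k).choose (m - l) : ℂ) ≠ 0 := by exact_mod_cast hC.ne'
    rw [hs, ← mul_inv, h1, inv_mul_cancel₀ h2]
  have hsc : starRingEnd ℂ s = s := by
    rw [hs, map_inv₀, Complex.conj_ofReal]
  rw [inner_eq_sum]
  have hterm : ∀ w, distVec m i (stateXi n m k l hk) w *
      starRingEnd ℂ (stateXi n m k l hk w) =
      if IsXiWord m k l w then s * s * (pairCount (n - k) (m - l) i : ℂ) else 0 := by
    intro w
    by_cases hw : IsXiWord m k l w
    · rw [if_pos hw, distVec_apply, if_pos hw.2]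
      simp only [stateXi_apply hk hlm hlk, ite_mul, zero_mul, hw, if_true]
      rw [← Finset.sum_filter, ← Finset.mul_sum, ← Nat.cast_sum,
        sum_choose_excess hk hlm hlk hw, hsc]
      ring
    · rw [if_neg hw, stateXi_apply hk hlm hlk w, if_neg hw, map_zero, mul_zero]
  rw [Finset.sum_congr rfl fun w _ => hterm w, ← Finset.sum_filter, Finset.sum_const,
    card_isXiWord hk hlm hlk, nsmul_eq_mul]
  linear_combination (pairCount (n - k) (m - l) i : ℂ) * hss

theorem pmf_eq {m k l x : ℕ} (hm : 2 * m ≤ n) (hk : k ≤ n) (hl : m + k ≤ n + l) (hlm : l ≤ m)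
    (hlk : l ≤ k) (hx : x ≤ m) :
    pmf n m k l hk x = spechtDim n x / n.choose m * racahSum n m k l x := by
  have h1 : (pmf n m k l hk x : ℂ) =
      ((spechtDim n x / n.choose m * racahSum n m k l x : ℝ) : ℂ) := by
    rw [pmf_eq_inner, projector_eq_hahnVec hm hx
      (fun w hw => weight_of_stateXi_ne_zero hk hlm hlk hw), inner_smul_right, hahnVec, inner_sum]
    simp only [inner_smul_right, inner_stateXi_distVec hk hl hlm hlk, racahSum]
    push_cast
    rfl
  exact_mod_cast h1

/-- The prefactor is the inverse of `spechtDim`, so the normalized probabilities are values of the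
Racah sum with a constant independent of $x$. -/
theorem mul_pmf_eq {m k l x : ℕ} (hm : 2 * m ≤ n) (hk : k ≤ n) (hl : m + k ≤ n + l)
    (hlm : l ≤ m) (hlk : l ≤ k) (hx : x ≤ m) :
    ((n : ℝ) - x + 1) / (n - 2 * x + 1) * (n.choose x : ℝ)⁻¹ * pmf n m k l hk x =
      racahSum n m k l x / n.choose m := by
  rw [pmf_eq hm hk hl hlm hlk hx, spechtDim]
  have hx' : (x : ℝ) ≤ m := by exact_mod_cast hx
  have hm' : 2 * (m : ℝ) ≤ n := by exact_mod_cast hm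
  have hx0 : (0 : ℝ) ≤ x := Nat.cast_nonneg x
  have h1 : (n : ℝ) - 2 * x + 1 ≠ 0 := (by linarith : 0 < (n : ℝ) - 2 * x + 1).ne'
  have h2 : (n : ℝ) - x + 1 ≠ 0 := (by linarith : 0 < (n : ℝ) - x + 1).ne'
  have h3 : (n.choose x : ℝ) ≠ 0 := Nat.cast_ne_zero.2 (Nat.choose_pos (by omega)).ne'
  have h4 : (n.choose m : ℝ) ≠ 0 := Nat.cast_ne_zero.2 (Nat.choose_pos (by omega)).ne'
  generalize (n : ℝ) - 2 * x + 1 = d at *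
  field_simp

theorem pmf_recurrence {m k l : ℕ} (hk : k ≤ n) (hl : m + k ≤ n + l) (hlm : l ≤ m)
    (hlk : l ≤ k) (hm : 2 * m ≤ n) {x : ℕ} (hx : x ≤ m) :
    (if x = m then 0 else
        recA n m k x * (((n : ℝ) - x) / ((n : ℝ) - 2 * x - 1)) *
          (n.choose (x + 1) : ℝ)⁻¹ * pmf n m k l hk (x + 1))
      - (recA n m k x + recC n m k x - ((m : ℝ) - l) * ((n : ℝ) - m - k + l)) *
          (((n : ℝ) - x + 1) / ((n : ℝ) - 2 * x + 1)) *
          (n.choose x : ℝ)⁻¹ * pmf n m k l hk x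
      + (if x = 0 then 0 else
          recC n m k x * (((n : ℝ) - x + 2) / ((n : ℝ) - 2 * x + 3)) *
            (n.choose (x - 1) : ℝ)⁻¹ * pmf n m k l hk (x - 1)) = 0 := by
  have hA : (if x = m then 0 else
        recA n m k x * (((n : ℝ) - x) / ((n : ℝ) - 2 * x - 1)) *
          (n.choose (x + 1) : ℝ)⁻¹ * pmf n m k l hk (x + 1)) =
      recA n m k x * (racahSum n m k l (x + 1) / n.choose m) := by
    split_ifs with h
    -- At $x=m$ the numerator of $a_x$ has the factor $m-x=0$, so the convention for the omitted
    -- term agrees with the Racah recurrence, also when $n=2m$.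
    · subst h; simp [recA]
    · have h1 := mul_pmf_eq hm hk hl hlm hlk (x := x + 1) (by omega)
      have e1 : (n : ℝ) - ((x + 1 : ℕ) : ℝ) + 1 = n - x := by push_cast; ring
      have e2 : (n : ℝ) - 2 * ((x + 1 : ℕ) : ℝ) + 1 = n - 2 * x - 1 := by push_cast; ring
      rw [e1, e2] at h1
      push_cast at h1
      rw [← h1]
      ring
  have hC : (if x = 0 then 0 else
          recC n m k x * (((n : ℝ) - x + 2) / ((n : ℝ) - 2 * x + 3)) *
            (n.choose (x - 1) : ℝ)⁻¹ * pmf n m k l hk (x - 1)) =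
      recC n m k x * (racahSum n m k l (x - 1) / n.choose m) := by
    split_ifs with h
    · subst h; simp [recC]
    · have h1 := mul_pmf_eq hm hk hl hlm hlk (x := x - 1) (by omega)
      have e0 : ((x - 1 : ℕ) : ℝ) = x - 1 := by
        rw [Nat.cast_sub (by omega)]; simp
      have e1 : (n : ℝ) - ((x : ℝ) - 1) + 1 = n - x + 2 := by ring
      have e2 : (n : ℝ) - 2 * ((x : ℝ) - 1) + 1 = n - 2 * x + 3 := by ring
      rw [e0, e1, e2] at h1
      rw [← h1]
      ring
  have hB := mul_pmf_eq hm hk hl hlm hlk hx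
  have hR := racahSum_difference hm hk hl hlm hx
  rw [hA, hC]
  linear_combination hR / n.choose m - (recA n m k x + recC n m k x -
    ((m : ℝ) - l) * (n - m - k + l)) * hB

end AsymState

theorem lemma4p10 (n m k l : ℕ) (hm : m ≤ n) (hk : k ≤ n)
    (hl : m + k ≤ n + l) (hlm : l ≤ m) (hlk : l ≤ k) :
    -- the three-term recurrence
    (m ≤ n - m → ∀ x : ℕ, x ≤ m →
      (if x = m then 0 else
          AsymState.recA n m k x * (((n : ℝ) - x) / ((n : ℝ) - 2 * x - 1)) *
            (n.choose (x + 1) : ℝ)⁻¹ * AsymState.pmf n m k l hk (x + 1))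
        - (AsymState.recA n m k x + AsymState.recC n m k x
              - ((m : ℝ) - l) * ((n : ℝ) - m - k + l)) *
            (((n : ℝ) - x + 1) / ((n : ℝ) - 2 * x + 1)) *
            (n.choose x : ℝ)⁻¹ * AsymState.pmf n m k l hk x
        + (if x = 0 then 0 else
            AsymState.recC n m k x * (((n : ℝ) - x + 2) / ((n : ℝ) - 2 * x + 3)) *
              (n.choose (x - 1) : ℝ)⁻¹ * AsymState.pmf n m k l hk (x - 1)) = 0) ∧
    -- the support of the distribution
    (∀ x : ℕ, 2 * x ≤ n → min (min m (n - m)) k < x → AsymState.pmf n m k l hk x = 0) :=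
  ⟨fun h _ hx => AsymState.pmf_recurrence hk hl hlm hlk (by omega) hx,
    fun _ hx h => AsymState.pmf_eq_zero hk hlm hlk hx h⟩
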